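/- For $n\ge 0$ let $\mathbb H^n$ be the standard right quaternionic vector space with the Hermitian form $K(v,w)=\sum_i \bar v_i w_i$, and let $Sp(n)$ be the group of right $\mathbb H$-linear automorphisms of $\mathbb H^n$ preserving $K$. Let $\Lambda^k(\mathbb H^n)^*\otimes\mathbb C$ be the space of complex-valued $\mathbb R$-multilinear alternating $k$-forms on $\mathbb H^n$. Identify $SU(2)$ with the group of unit quaternions via $$z_1+jz_2\mapsto\begin{pmatrix} z_1&-\bar z_2\\ z_2&\bar z_1\end{pmatrix}\qquad(z_1,z_2\in\mathbb C);$$ it acts on forms by pullback along the right multiplications $v\mapsto vq$, and this action preserves the $Sp(n)$-invariant forms. Let $V_k=\mathrm{Sym}^k\,\mathbb C^2$, where $\mathbb C^2$ is the standard representation of $SU(2)$. Fix any sequence of embeddings $\mathbb H^0\hookrightarrow\mathbb H^1\hookrightarrow\mathbb H^2\hookrightarrow\cdots$ that are right $\mathbb H$-linear and preserve $K$. Let $(\Lambda^k(\mathbb H^\infty)^*\otimes\mathbb C)^{Sp(\infty)}$ be the inverse limit over $n$ of the spaces $(\Lambda^k(\mathbb H^n)^*\otimes\mathbb C)^{Sp(n)}$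 along the restriction maps, and let $$(\Lambda^*(\mathbb H^\infty)^*\otimes\mathbb C)^{Sp(\infty)}=\bigoplus_{k\ge0}(\Lambda^k(\mathbb H^\infty)^*\otimes\mathbb C)^{Sp(\infty)},$$ with the wedge product and the induced $SU(2)$-action. **Proposition.** (i) The graded $SU(2)$-algebra $(\Lambda^*(\mathbb H^\infty)^*\otimes\mathbb C)^{Sp(\infty)}$ is freely generated by one copy of $V_2$ in degree $2$: there is an $SU(2)$-equivariant linear map $V_2\to(\Lambda^2(\mathbb H^\infty)^*\otimes\mathbb C)^{Sp(\infty)}$ that extends to an isomorphism of algebras from the symmetric algebra $\mathrm{Sym}(V_2)$ onto $(\Lambda^*(\mathbb H^\infty)^*\otimes\mathbb C)^{Sp(\infty)}$. (ii) For all $k,n\ge0$ the restriction map $$u_n:(\Lambda^k(\mathbb H^\infty)^*\otimes\mathbb C)^{Sp(\infty)}\to(\Lambda^k(\mathbb H^n)^*\otimes\mathbb C)^{Sp(n)}$$ commutes with the $SU(2)$-action and is surjective, and it is injective if $n\ge k$. -/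

import Mathlib

open scoped Quaternion DirectSum

noncomputable section

namespace QuatForms

/-! ### The group `SU(2)`, its identification with the unit quaternions, and `V_k` -/

/-- The group `SU(2)`. -/
abbrev SU2 : Type := Matrix.specialUnitaryGroup (Fin 2) ℂ

/-- The matrix of left multiplication by `q` on `ℍ = ℂ ⊕ jℂ`: if `q = z₁ + j z₂`, it is
`(z₁, -conj z₂; z₂, conj z₁)`. Since `j (c + d i) = c j - d k`, one has
`z₁ = q.re + q.imI * i` and `z₂ = q.imJ - q.imK * i`. -/
def quatMatrix (q : ℍ[ℝ]) : Matrix (Fin 2) (Fin 2) ℂ :=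
  !![⟨q.re, q.imI⟩, -⟨q.imJ, q.imK⟩; ⟨q.imJ, -q.imK⟩, ⟨q.re, -q.imI⟩]

lemma quatMatrix_mul (p q : ℍ[ℝ]) : quatMatrix (p * q) = quatMatrix p * quatMatrix q := by
  ext i j
  fin_cases i <;> fin_cases j <;>
    simp [quatMatrix, Matrix.mul_apply, Fin.sum_univ_two, Complex.ext_iff] <;>
    constructor <;> ring

lemma quatMatrix_one : quatMatrix 1 = 1 := by
  ext i j
  fin_cases i <;> fin_cases j <;> simp [quatMatrix, Complex.ext_iff]

lemma quatMatrix_injective : Function.Injective quatMatrix := by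
  intro p q h
  have h0 := congrFun (congrFun h 0) 0
  have h1 := congrFun (congrFun h 1) 0
  simp [quatMatrix] at h0 h1
  ext
  exacts [h0.1, h0.2, h1.1, h1.2]

/-- The quaternion `z₁ + j z₂` whose matrix has first column `(z₁, z₂)`. -/
def quatOfMatrix (A : Matrix (Fin 2) (Fin 2) ℂ) : ℍ[ℝ] :=
  ⟨(A 0 0).re, (A 0 0).im, (A 1 0).re, -(A 1 0).im⟩

lemma quatMatrix_quatOfMatrix (A : SU2) : quatMatrix (quatOfMatrix A.1) = A.1 := by
  obtain ⟨A, hA⟩ := A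
  obtain ⟨hU, hdet⟩ := Matrix.mem_specialUnitaryGroup_iff.1 hA
  have hs : star A = A.adjugate := by
    have h1 : star A * A = 1 := (Matrix.mem_unitaryGroup_iff').1 hU
    have h2 : A * A.adjugate = 1 := by rw [Matrix.mul_adjugate, hdet, one_smul]
    calc star A = star A * (A * A.adjugate) := by rw [h2, mul_one]
      _ = A.adjugate := by rw [← mul_assoc, h1, one_mul]
  rw [Matrix.adjugate_fin_two] at hs
  have e00 := congrFun (congrFun hs 0) 0
  have e01 := congrFun (congrFun hs 0) 1
  simp [Matrix.star_apply, Complex.ext_iff] at e00 e01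
  ext i j
  fin_cases i <;> fin_cases j <;> simp [quatMatrix, quatOfMatrix, Complex.ext_iff]
  · constructor <;> linarith [e01.1, e01.2]
  · constructor <;> linarith [e00.1, e00.2]

/-- The identification of `SU(2)` with the group of unit quaternions. -/
def su2ToQuat : SU2 →* ℍ[ℝ] where
  toFun A := quatOfMatrix A.1
  map_one' := quatMatrix_injective <| by
    rw [quatMatrix_quatOfMatrix, quatMatrix_one]; rfl
  map_mul' A B := quatMatrix_injective <| by
    rw [quatMatrix_mul, quatMatrix_quatOfMatrix, quatMatrix_quatOfMatrix,
      quatMatrix_quatOfMatrix]; rfl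

/-- The action of `SU(2)` by algebra automorphisms on the symmetric algebra of its standard
representation `ℂ²`. -/
def symRep : Representation ℂ SU2 (SymmetricAlgebra ℂ (Fin 2 → ℂ)) where
  toFun A := (SymmetricAlgebra.lift
    (SymmetricAlgebra.ι ℂ (Fin 2 → ℂ) ∘ₗ A.1.mulVecLin)).toLinearMap
  map_one' := by
    have h : SymmetricAlgebra.lift (SymmetricAlgebra.ι ℂ (Fin 2 → ℂ) ∘ₗ
        (1 : SU2).1.mulVecLin) = AlgHom.id ℂ _ := by
      apply SymmetricAlgebra.algHom_ext
      ext v; simp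
    rw [h]; rfl
  map_mul' A B := by
    have h : SymmetricAlgebra.lift (SymmetricAlgebra.ι ℂ (Fin 2 → ℂ) ∘ₗ (A * B).1.mulVecLin) =
        (SymmetricAlgebra.lift (SymmetricAlgebra.ι ℂ (Fin 2 → ℂ) ∘ₗ A.1.mulVecLin)).comp
        (SymmetricAlgebra.lift (SymmetricAlgebra.ι ℂ (Fin 2 → ℂ) ∘ₗ B.1.mulVecLin)) := by
      apply SymmetricAlgebra.algHom_ext
      ext v; simp
    rw [h]; rfl

/-- `Sym^k ℂ²`, the degree `k` part of the symmetric algebra of `ℂ²`, as a subrepresentation. -/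
def symPower (k : ℕ) : Subrepresentation symRep where
  toSubmodule := LinearMap.range (SymmetricAlgebra.ι ℂ (Fin 2 → ℂ)) ^ k
  apply_mem_toSubmodule A x hx := by
    have hle : (LinearMap.range (SymmetricAlgebra.ι ℂ (Fin 2 → ℂ)) ^ k).map (symRep A) ≤
        LinearMap.range (SymmetricAlgebra.ι ℂ (Fin 2 → ℂ)) ^ k := by
      refine (Submodule.map_pow _ (SymmetricAlgebra.lift
        (SymmetricAlgebra.ι ℂ (Fin 2 → ℂ) ∘ₗ A.1.mulVecLin)) k).trans_le (pow_le_pow_left' ?_ k)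
      rintro _ ⟨_, ⟨v, rfl⟩, rfl⟩
      exact ⟨A.1.mulVec v, by simp⟩
    exact hle ⟨x, hx, rfl⟩

/-- The underlying space of the irreducible representation `V_k = Sym^k ℂ²`. -/
abbrev V (k : ℕ) : Type := (symPower k).toSubmodule

/-- The irreducible representation `V_k = Sym^k ℂ²` of `SU(2)`, of dimension `k + 1`. -/
abbrev repV (k : ℕ) : Representation ℂ SU2 (V k) := (symPower k).toRepresentation

/-! ### Quaternionic isometries and the compact symplectic group -/

/-- The right quaternionic vector space `ℍ^n`. -/
abbrev Hn (n : ℕ) : Type := Fin n → ℍ[ℝ]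

/-- The standard quaternionic Hermitian form `K(v, w) = ∑ conj(v_i) w_i`. -/
def K {n : ℕ} (v w : Hn n) : ℍ[ℝ] := ∑ i, star (v i) * w i

/-- A quaternionic isometric embedding: a right `ℍ`-linear map preserving `K`
(injective because `K` is positive definite). -/
structure IsoEmb (m n : ℕ) where
  toLin : Hn m →ₗ[ℍ[ℝ]ᵐᵒᵖ] Hn n
  preserves : ∀ v w, K (toLin v) (toLin w) = K v w

/-- The compact symplectic group `Sp(n)`: right `ℍ`-linear automorphisms of `ℍ^n` preserving
`K`. -/
def Sp (n : ℕ) : Subgroup (Hn n ≃ₗ[ℍ[ℝ]ᵐᵒᵖ] Hn n) where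
  carrier := {g | ∀ v w, K (g v) (g w) = K v w}
  one_mem' _ _ := rfl
  mul_mem' {g h} hg hh v w := (hg (h v) (h w)).trans (hh v w)
  inv_mem' {g} hg v w := by
    have := hg (g⁻¹ v) (g⁻¹ w)
    have e : ∀ x, g (g⁻¹ x) = x := g.apply_symm_apply
    rw [e, e] at this
    exact this.symm

/-- Right multiplication by a quaternion on `ℍ^n`. -/
def rightMul (n : ℕ) (q : ℍ[ℝ]) : Hn n →ₗ[ℝ] Hn n where
  toFun v i := v i * q
  map_add' v w := by ext1 i; exact add_mul _ _ _
  map_smul' c v := by ext1 i; exact smul_mul_assoc c (v i) q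

/-! ### Complex-valued forms and pullbacks -/

/-- `Λ^*(ℍ^n)^* ⊗ ℂ`, as the exterior algebra over `ℂ` of the space
`(ℍ^n)^* ⊗ ℂ = Hom_ℝ(ℍ^n, ℂ)` of complex-valued real-linear forms. -/
abbrev Forms (n : ℕ) : Type := ExteriorAlgebra ℂ (Hn n →ₗ[ℝ] ℂ)

/-- The degree `k` part `Λ^k(ℍ^n)^* ⊗ ℂ`. -/
abbrev FormsDeg (n k : ℕ) : Submodule ℂ (Forms n) := ⋀[ℂ]^k (Hn n →ₗ[ℝ] ℂ)

/-- The pullback of forms along a real-linear map. -/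
def pullback {m n : ℕ} (f : Hn m →ₗ[ℝ] Hn n) : Forms n →ₐ[ℂ] Forms m :=
  ExteriorAlgebra.map (LinearMap.lcomp ℂ ℂ f)

lemma pullback_comp {l m n : ℕ} (f : Hn l →ₗ[ℝ] Hn m) (g : Hn m →ₗ[ℝ] Hn n) (ω : Forms n) :
    pullback f (pullback g ω) = pullback (g ∘ₗ f) ω := by
  have := ExteriorAlgebra.map_comp_map (LinearMap.lcomp ℂ ℂ g) (LinearMap.lcomp ℂ ℂ f)
  exact DFunLike.congr_fun this ω

lemma pullback_id {n : ℕ} : pullback (LinearMap.id : Hn n →ₗ[ℝ] Hn n) = AlgHom.id ℂ _ :=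
  ExteriorAlgebra.map_id

lemma pullback_mem {m n k : ℕ} (f : Hn m →ₗ[ℝ] Hn n) {ω : Forms n} (hω : ω ∈ FormsDeg n k) :
    pullback f ω ∈ FormsDeg m k := by
  have hle : (FormsDeg n k).map (pullback f).toLinearMap ≤ FormsDeg m k := by
    refine (Submodule.map_pow _ (pullback f) k).trans_le (pow_le_pow_left' ?_ k)
    rintro _ ⟨_, ⟨φ, rfl⟩, rfl⟩
    exact ⟨LinearMap.lcomp ℂ ℂ f φ, (ExteriorAlgebra.map_apply_ι _ _).symm⟩
  exact hle ⟨ω, hω, rfl⟩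

lemma rightMul_comm {m n : ℕ} (f : Hn m →ₗ[ℍ[ℝ]ᵐᵒᵖ] Hn n) (q : ℍ[ℝ]) :
    rightMul n q ∘ₗ f.restrictScalars ℝ = f.restrictScalars ℝ ∘ₗ rightMul m q := by
  refine LinearMap.ext fun v => ?_
  exact (f.map_smul (MulOpposite.op q) v).symm

/-- The action of `SU(2)`, i.e. of the unit quaternions, on forms, induced by right multiplication
on `ℍ^n`: the element `q` sends `ω` to its pullback along `v ↦ v q`. -/
def formsRep (n : ℕ) : Representation ℂ SU2 (Forms n) where
  toFun A := (pullback (rightMul n (su2ToQuat A))).toLinearMap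
  map_one' := by
    have : rightMul n (su2ToQuat 1) = LinearMap.id := by
      refine LinearMap.ext fun v => funext fun i => ?_
      change v i * su2ToQuat 1 = v i
      rw [map_one, mul_one]
    rw [this, pullback_id]; rfl
  map_mul' A B := by
    refine LinearMap.ext fun ω => ?_
    refine Eq.trans ?_ (pullback_comp (rightMul n (su2ToQuat A)) (rightMul n (su2ToQuat B)) ω).symm
    have : rightMul n (su2ToQuat (A * B)) =
        rightMul n (su2ToQuat B) ∘ₗ rightMul n (su2ToQuat A) := by
      refine LinearMap.ext fun v => funext fun i => ?_
      change v i * su2ToQuat (A * B) = v i * su2ToQuat A * su2ToQuat B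
      rw [map_mul, mul_assoc]
    rw [this]; rfl

/-! ### Invariant forms and their graded inverse limit -/

/-- `(Λ^k(ℍ^n)^* ⊗ ℂ)^{Sp(n)}`, as an `SU(2)`-subrepresentation of the space of forms. -/
def invForms (n k : ℕ) : Subrepresentation (formsRep n) where
  toSubmodule :=
    { carrier := {ω | ω ∈ FormsDeg n k ∧
        ∀ g ∈ Sp n, pullback (g.toLinearMap.restrictScalars ℝ) ω = ω}
      zero_mem' := ⟨zero_mem _, fun _ _ => map_zero _⟩
      add_mem' := fun ha hb => ⟨add_mem ha.1 hb.1, fun g hg => by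
        rw [map_add, ha.2 g hg, hb.2 g hg]⟩
      smul_mem' := fun c _ ha => ⟨Submodule.smul_mem _ c ha.1, fun g hg => by
        rw [map_smul, ha.2 g hg]⟩ }
  apply_mem_toSubmodule A ω hω := by
    refine ⟨pullback_mem _ hω.1, fun g hg => ?_⟩
    change pullback _ (pullback (rightMul n (su2ToQuat A)) ω) = pullback _ ω
    rw [pullback_comp, rightMul_comm, ← pullback_comp, hω.2 g hg]

/-- The representation of `SU(2)` on `(Λ^k(ℍ^n)^* ⊗ ℂ)^{Sp(n)}`. -/
abbrev invRep (n k : ℕ) : Representation ℂ SU2 (invForms n k).toSubmodule :=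
  (invForms n k).toRepresentation

/-- The componentwise `SU(2)`-action on sequences of forms `ω_n` on `ℍ^n`. -/
def seqRep : Representation ℂ SU2 (∀ n, Forms n) where
  toFun A := LinearMap.pi fun n => formsRep n A ∘ₗ LinearMap.proj n
  map_one' := by refine LinearMap.ext fun ω => funext fun n => ?_; simp
  map_mul' A B := by refine LinearMap.ext fun ω => funext fun n => ?_; simp

/-- `(Λ^k(ℍ^∞)^* ⊗ ℂ)^{Sp(∞)}`: the inverse limit over `n` of `(Λ^k(ℍ^n)^* ⊗ ℂ)^{Sp(n)}` along the
restriction maps of the given embeddings `ℍ^n → ℍ^{n+1}`, realised as the space of compatible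
sequences of invariant `k`-forms. -/
def limForms (ι : ∀ n, IsoEmb n (n + 1)) (k : ℕ) : Subrepresentation seqRep where
  toSubmodule :=
    { carrier := {ω | (∀ n, ω n ∈ (invForms n k).toSubmodule) ∧
        ∀ n, pullback ((ι n).toLin.restrictScalars ℝ) (ω (n + 1)) = ω n}
      zero_mem' := ⟨fun _ => zero_mem _, fun _ => map_zero _⟩
      add_mem' := fun ha hb => ⟨fun n => add_mem (ha.1 n) (hb.1 n), fun n => by
        rw [Pi.add_apply, map_add, ha.2 n, hb.2 n, Pi.add_apply]⟩
      smul_mem' := fun c _ ha => ⟨fun n => Submodule.smul_mem _ c (ha.1 n), fun n => by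
        rw [Pi.smul_apply, map_smul, ha.2 n, Pi.smul_apply]⟩ }
  apply_mem_toSubmodule A ω hω := by
    refine ⟨fun n => (invForms n k).apply_mem_toSubmodule A (hω.1 n), fun n => ?_⟩
    change pullback _ (pullback (rightMul (n + 1) (su2ToQuat A)) (ω (n + 1))) = pullback _ (ω n)
    rw [pullback_comp, rightMul_comm, ← pullback_comp, hω.2 n]

/-- The representation of `SU(2)` on `(Λ^k(ℍ^∞)^* ⊗ ℂ)^{Sp(∞)}`. -/
abbrev limRep (ι : ∀ n, IsoEmb n (n + 1)) (k : ℕ) :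
    Representation ℂ SU2 (limForms ι k).toSubmodule :=
  (limForms ι k).toRepresentation

/-- The degree `k` part of the limit, as a submodule of the algebra of all sequences of forms. -/
abbrev LimDeg (ι : ∀ n, IsoEmb n (n + 1)) (k : ℕ) : Submodule ℂ (∀ n, Forms n) :=
  (limForms ι k).toSubmodule

/-- The componentwise wedge product is compatible with the grading; this makes
`⨁ k, LimDeg ι k` a graded `ℂ`-algebra. -/
instance limGradedMonoid (ι : ∀ n, IsoEmb n (n + 1)) : SetLike.GradedMonoid (LimDeg ι) where
  one_mem := by
    refine ⟨fun n => ⟨?_, fun g _ => map_one _⟩, fun n => map_one _⟩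
    exact SetLike.GradedOne.one_mem (A := fun i : ℕ => FormsDeg n i)
  mul_mem k l a b ha hb := by
    refine ⟨fun n => ⟨?_, fun g hg => ?_⟩, fun n => ?_⟩
    · exact SetLike.GradedMul.mul_mem (A := fun i : ℕ => FormsDeg n i) (ha.1 n).1 (hb.1 n).1
    · rw [Pi.mul_apply, map_mul, (ha.1 n).2 g hg, (hb.1 n).2 g hg]
    · rw [Pi.mul_apply, map_mul, ha.2 n, hb.2 n, Pi.mul_apply]

/-- The graded algebra `(Λ^*(ℍ^∞)^* ⊗ ℂ)^{Sp(∞)}`, the inverse limit in graded algebras: the direct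
sum over `k` of the degreewise inverse limits. -/
abbrev LimAlg (ι : ∀ n, IsoEmb n (n + 1)) : Type := ⨁ k, LimDeg ι k

/-- The restriction map
`u_n : (Λ^k(ℍ^∞)^* ⊗ ℂ)^{Sp(∞)} → (Λ^k(ℍ^n)^* ⊗ ℂ)^{Sp(n)}`. -/
def restr (ι : ∀ n, IsoEmb n (n + 1)) (k n : ℕ) :
    (limForms ι k).toSubmodule →ₗ[ℂ] (invForms n k).toSubmodule where
  toFun ω := ⟨ω.1 n, ω.2.1 n⟩
  map_add' _ _ := rfl
  map_smul' _ _ := rfl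

end QuatForms

end

namespace QuatForms

noncomputable section

open ExteriorAlgebra CliffordAlgebra

/-! ### Exterior algebras: pairs of generators and contractions -/

section Exterior

variable {R M N : Type*} [CommRing R] [AddCommGroup M] [Module R M] [AddCommGroup N] [Module R N]

/-! Replace each entry of a vector in `ℍ^n` by its 2×2 complex matrix. Left multiplication then acts
on the row index `a` of the coordinate one-forms `dz i a b`, and right multiplication on the column
index `b`. Contracting the row indices with the symplectic form and summing over the sites `i` gives
two-forms `G n b c`, symmetric in `b, c`. They depend on `K` alone, so every isometric embedding
pulls them back to each other (`IsoEmb.pullback_G`), and under `SU(2)` they transform like the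
products `e_b e_c` in `V_2`. Products of two one-forms are central, so these computations take place
in the commutative ring `Z n`. Everything rests on two facts about `ev n`, the evaluation of
polynomials in three variables at `G n 0 0`, `G n 0 1`, `G n 1 1`.

Generation (`exists_eq_ev_of_mem_invariants`), by induction on `n`. An invariant form on `ℍ^{n+1}`
is expanded in monomials at the first site, with coefficients that are invariant on `ℍ^n`, hence
polynomials in `G (n+1) - tau 0`. The quaternion group of order 8 acting on the left at this site
already has the right invariants: averaging leaves only 1, the three `tau 0 b c` and `vol 0`.
Averaging over permutations of the sites turns each `tau` into a generator, leaving a term `p(G) *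
volSum` which is itself invariant. Invariance under mixing two sites then forces this term to be a
multiple of `p * (G00 * G11 - G01 ^ 2)` (`ev_mul_volSum`).

Independence (`eq_zero_of_ev_eq_zero`). A double contraction at the first site followed by
restriction to `ℍ^n` acts on `ev (n+1) p` as a nonzero multiple of a partial derivative, so no
nonzero polynomial of degree at most `n` vanishes under `ev n`.

Consequently a compatible sequence of invariant `k`-forms comes from a single polynomial
(`eq_evSeq`). This identifies the limit algebra with polynomials in three variables, whatever the
embeddings, and gives surjectivity and stable injectivity of the restrictions. -/

lemma ι_mul_ι_swap (x y : M) :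
    ExteriorAlgebra.ι R y * ExteriorAlgebra.ι R x =
      -(ExteriorAlgebra.ι R x * ExteriorAlgebra.ι R y) :=
  eq_neg_of_add_eq_zero_right (ExteriorAlgebra.ι_add_mul_swap x y)

/-- A product of two generators is central. -/
lemma ι_mul_ι_mem_center (x y : M) :
    ExteriorAlgebra.ι R x * ExteriorAlgebra.ι R y ∈
      Subalgebra.center R (ExteriorAlgebra R M) := by
  rw [Subalgebra.mem_center_iff]
  intro b
  induction b using ExteriorAlgebra.induction with
  | algebraMap r => exact Algebra.commutes _ _
  | ι z =>
    rw [← mul_assoc, ι_mul_ι_swap x z, neg_mul, mul_assoc, ι_mul_ι_swap y z, mul_neg, neg_neg,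
      mul_assoc]
  | mul a b ha hb => rw [mul_assoc, hb, ← mul_assoc, ha, mul_assoc]
  | add a b ha hb => rw [add_mul, mul_add, ha, hb]

/-- Contraction of an exterior form with a vector of the dual space. -/
abbrev contract (d : Module.Dual R M) : ExteriorAlgebra R M →ₗ[R] ExteriorAlgebra R M :=
  contractLeft (Q := (0 : QuadraticForm R M)) d

lemma contract_ι_mul (d : Module.Dual R M) (a : M) (b : ExteriorAlgebra R M) :
    contract d (ExteriorAlgebra.ι R a * b) = d a • b - ExteriorAlgebra.ι R a * contract d b :=
  contractLeft_ι_mul d a b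

lemma contract_algebraMap (d : Module.Dual R M) (r : R) :
    contract d (algebraMap R (ExteriorAlgebra R M) r) = 0 :=
  contractLeft_algebraMap (0 : QuadraticForm R M) d r

@[elab_as_elim]
lemma exterior_left_induction {P : ExteriorAlgebra R M → Prop}
    (algebraMap : ∀ r, P (algebraMap R _ r))
    (add : ∀ x y, P x → P y → P (x + y))
    (ι_mul : ∀ x m, P x → P (ExteriorAlgebra.ι R m * x)) (x : ExteriorAlgebra R M) : P x :=
  CliffordAlgebra.left_induction (Q := (0 : QuadraticForm R M)) algebraMap add ι_mul x

lemma contract_map (f : M →ₗ[R] N) (d : Module.Dual R N) (ω : ExteriorAlgebra R M) :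
    contract d (ExteriorAlgebra.map f ω) = ExteriorAlgebra.map f (contract (d ∘ₗ f) ω) := by
  induction ω using exterior_left_induction with
  | algebraMap r =>
    rw [AlgHom.commutes, contract_algebraMap, contract_algebraMap, map_zero]
  | add x y hx hy => simp only [map_add, hx, hy]
  | ι_mul x m hx =>
    rw [map_mul, ExteriorAlgebra.map_apply_ι, contract_ι_mul, contract_ι_mul, hx, map_sub,
      map_smul, map_mul, ExteriorAlgebra.map_apply_ι]
    rfl

/-- The pullback along `v ↦ v - d(v) e` in terms of the contraction with `d`. -/
lemma map_id_sub_smulRight (d : Module.Dual R M) (e : M) (ω : ExteriorAlgebra R M) :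
    ExteriorAlgebra.map (LinearMap.id - d.smulRight e) ω =
      ω - ExteriorAlgebra.ι R e * contract d ω := by
  induction ω using exterior_left_induction with
  | algebraMap r =>
    rw [AlgHom.commutes, contract_algebraMap, mul_zero, sub_zero]
  | add x y hx hy => simp only [map_add, hx, hy, mul_add]; abel
  | ι_mul x m hx =>
    rw [map_mul, ExteriorAlgebra.map_apply_ι, contract_ι_mul, hx]
    have h1 := ExteriorAlgebra.ι_sq_zero (R := R) e
    have h2 := ι_mul_ι_swap (R := R) e m
    simp only [LinearMap.sub_apply, LinearMap.id_apply, LinearMap.smulRight_apply, map_sub,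
      map_smul, sub_mul, mul_sub, smul_mul_assoc, mul_smul_comm, ← mul_assoc, h1, h2, zero_mul,
      smul_zero, neg_mul]
    abel

lemma contract_contract (d : Module.Dual R M) (ω : ExteriorAlgebra R M) :
    contract d (contract d ω) = 0 := contractLeft_contractLeft _ _

lemma contract_comm (d d' : Module.Dual R M) (ω : ExteriorAlgebra R M) :
    contract d (contract d' ω) = -contract d' (contract d ω) := contractLeft_comm _ _ _

end Exterior

/-! ### Two-forms and their values on pairs of vectors -/

section Covectors

variable {V κ κ' : Type*} [AddCommGroup V] [Module ℝ V] [FiniteDimensional ℝ V]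
  [Fintype κ] [Fintype κ']

/-- The complexification of the dual basis of a basis of `V`. -/
def dualCovector (V : Type*) [AddCommGroup V] [Module ℝ V] [FiniteDimensional ℝ V]
    (a : Fin (Module.finrank ℝ V)) : V →ₗ[ℝ] ℂ :=
  Complex.ofRealCLM.toLinearMap ∘ₗ (Module.finBasis ℝ V).coord a

lemma covector_eq_sum (u : V →ₗ[ℝ] ℂ) :
    u = ∑ a, u (Module.finBasis ℝ V a) • dualCovector V a := by
  refine (Module.finBasis ℝ V).ext fun b => ?_
  rw [LinearMap.sum_apply, Finset.sum_eq_single b]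
  · simp [dualCovector]
  · intro a _ hab
    simp [dualCovector, hab.symm]
  · simp

lemma ι_mul_ι_eq_sum (u u' : V →ₗ[ℝ] ℂ) :
    ExteriorAlgebra.ι ℂ u * ExteriorAlgebra.ι ℂ u' =
      ∑ a, ∑ b, (u (Module.finBasis ℝ V a) * u' (Module.finBasis ℝ V b)) •
        (ExteriorAlgebra.ι ℂ (dualCovector V a) * ExteriorAlgebra.ι ℂ (dualCovector V b)) := by
  conv_lhs => rw [covector_eq_sum u, covector_eq_sum u']
  simp only [map_sum, map_smul, Finset.sum_mul_sum, smul_mul_smul_comm]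

/-- Doubling antisymmetrises the coefficients, so that they become the values of the two-form on
pairs of basis vectors. -/
lemma two_smul_sum_ι_mul_ι (u u' : κ → V →ₗ[ℝ] ℂ) :
    (2 : ℂ) • ∑ k, ExteriorAlgebra.ι ℂ (u k) * ExteriorAlgebra.ι ℂ (u' k) =
      ∑ a, ∑ b, (∑ k, (u k (Module.finBasis ℝ V a) * u' k (Module.finBasis ℝ V b) -
          u k (Module.finBasis ℝ V b) * u' k (Module.finBasis ℝ V a))) •
        (ExteriorAlgebra.ι ℂ (dualCovector V a) * ExteriorAlgebra.ι ℂ (dualCovector V b)) := by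
  have key (u u' : V →ₗ[ℝ] ℂ) :
      (2 : ℂ) • (ExteriorAlgebra.ι ℂ u * ExteriorAlgebra.ι ℂ u') =
        ∑ a, ∑ b, (u (Module.finBasis ℝ V a) * u' (Module.finBasis ℝ V b) -
          u (Module.finBasis ℝ V b) * u' (Module.finBasis ℝ V a)) •
          (ExteriorAlgebra.ι ℂ (dualCovector V a) * ExteriorAlgebra.ι ℂ (dualCovector V b)) := by
    rw [two_smul]
    nth_rw 2 [ι_mul_ι_swap u' u]
    rw [ι_mul_ι_eq_sum u' u, ι_mul_ι_eq_sum u u', ← sub_eq_add_neg]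
    simp only [← Finset.sum_sub_distrib, ← sub_smul]
    simp only [mul_comm]
  simp only [Finset.smul_sum, key, Finset.sum_smul]
  rw [Finset.sum_comm]
  exact Finset.sum_congr rfl fun a _ => Finset.sum_comm

/-- A sum of products of two covectors is determined by its values on pairs of vectors. -/
lemma sum_ι_mul_ι_eq (u u' : κ → V →ₗ[ℝ] ℂ) (s s' : κ' → V →ₗ[ℝ] ℂ)
    (h : ∀ v w, ∑ k, (u k v * u' k w - u k w * u' k v) =
      ∑ l, (s l v * s' l w - s l w * s' l v)) :
    ∑ k, ExteriorAlgebra.ι ℂ (u k) * ExteriorAlgebra.ι ℂ (u' k) =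
      ∑ l, ExteriorAlgebra.ι ℂ (s l) * ExteriorAlgebra.ι ℂ (s' l) := by
  refine smul_right_injective _ (two_ne_zero (α := ℂ)) ?_
  change (2 : ℂ) • _ = (2 : ℂ) • _
  rw [two_smul_sum_ι_mul_ι, two_smul_sum_ι_mul_ι]
  simp only [h]

end Covectors

/-! ### Coordinates on `ℍ^n` -/

/-- The complex coordinate `v ↦ (quatMatrix v_i)_{ab}` on `ℍ^n`. -/
def coord {n : ℕ} (i : Fin n) (a b : Fin 2) : Hn n →ₗ[ℝ] ℂ where
  toFun v := quatMatrix (v i) a b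
  map_add' v w := by
    fin_cases a <;> fin_cases b <;> simp [quatMatrix, Complex.ext_iff] <;>
      (try constructor) <;> ring
  map_smul' c v := by
    fin_cases a <;> fin_cases b <;> simp [quatMatrix, Complex.ext_iff]

lemma coord_apply {n : ℕ} (i : Fin n) (a b : Fin 2) (v : Hn n) :
    coord i a b v = quatMatrix (v i) a b := rfl

/-- The coordinate one-forms. -/
def dz {n : ℕ} (i : Fin n) (a b : Fin 2) : Forms n := ExteriorAlgebra.ι ℂ (coord i a b)

lemma dz_swap {n : ℕ} (i j : Fin n) (a b c d : Fin 2) :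
    dz i a b * dz j c d = -(dz j c d * dz i a b) := ι_mul_ι_swap _ _

lemma pullback_ι {m n : ℕ} (f : Hn m →ₗ[ℝ] Hn n) (u : Hn n →ₗ[ℝ] ℂ) :
    pullback f (ExteriorAlgebra.ι ℂ u) = ExteriorAlgebra.ι ℂ (u ∘ₗ f) :=
  ExteriorAlgebra.map_apply_ι _ _

lemma pullback_dz {m n : ℕ} (f : Hn m →ₗ[ℝ] Hn n) (i : Fin n) (a b : Fin 2) :
    pullback f (dz i a b) = ExteriorAlgebra.ι ℂ (coord i a b ∘ₗ f) := pullback_ι _ _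

/-- The centre of the algebra of forms. -/
def Z (n : ℕ) : Type := Subalgebra.center ℂ (Forms n)

instance (n : ℕ) : CommRing (Z n) := inferInstanceAs (CommRing (Subalgebra.center ℂ (Forms n)))

instance (n : ℕ) : Algebra ℂ (Z n) := inferInstanceAs (Algebra ℂ (Subalgebra.center ℂ (Forms n)))

/-- The inclusion of the centre in the algebra of forms. -/
def Z.val (n : ℕ) : Z n →ₐ[ℂ] Forms n := (Subalgebra.center ℂ (Forms n)).val

instance (n : ℕ) : CoeOut (Z n) (Forms n) := ⟨fun z => Z.val n z⟩

lemma Z.val_injective (n : ℕ) : Function.Injective (Z.val n) := Subtype.val_injective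

/-- The product of two coordinate one-forms at a site, one for each row. -/
def sitePair {n : ℕ} (i : Fin n) (b c : Fin 2) : Z n :=
  show Subalgebra.center ℂ (Forms n) from ⟨dz i 0 b * dz i 1 c, ι_mul_ι_mem_center _ _⟩

/-- The symmetrised `sitePair`. -/
def tau {n : ℕ} (i : Fin n) (b c : Fin 2) : Z n := sitePair i b c + sitePair i c b

/-- The volume form at a site. -/
def vol {n : ℕ} (i : Fin n) : Z n := sitePair i 0 0 * sitePair i 1 1

/-- The invariant two-forms. -/
def G (n : ℕ) (b c : Fin 2) : Z n := ∑ i, tau i b c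

/-- The row-0 one-forms anticommute; exchanging them past the row-1 factor costs only one overall
sign. All multiplication rules at a site follow from this. -/
lemma sitePair_mul_swap {n : ℕ} (i : Fin n) (b c b' c' : Fin 2) :
    sitePair i b c * sitePair i b' c' = -(sitePair i b' c * sitePair i b c') := by
  refine Z.val_injective n ?_
  rw [map_neg, map_mul, map_mul]
  change dz i 0 b * dz i 1 c * (dz i 0 b' * dz i 1 c') =
    -(dz i 0 b' * dz i 1 c * (dz i 0 b * dz i 1 c'))
  rw [mul_assoc, ← mul_assoc (dz i 1 c), dz_swap i i 1 c 0 b', mul_assoc (dz i 0 b'),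
    ← mul_assoc (dz i 1 c), dz_swap i i 1 c 0 b]
  simp only [neg_mul, mul_neg, ← mul_assoc, dz_swap i i 0 b 0 b']

lemma eq_zero_of_eq_neg {n : ℕ} {x : Z n} (h : x = -x) : x = 0 := by
  have h2 : (2 : ℂ) • x = 0 := by rw [two_smul]; nth_rw 1 [h]; exact neg_add_cancel x
  exact (smul_eq_zero.1 h2).resolve_left two_ne_zero

lemma sitePair_mul_right {n : ℕ} (i : Fin n) (b c c' : Fin 2) :
    sitePair i b c * sitePair i b c' = 0 := by
  have h := sitePair_mul_swap i b c b c'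
  exact eq_zero_of_eq_neg h

lemma sitePair_mul_left {n : ℕ} (i : Fin n) (b b' c : Fin 2) :
    sitePair i b c * sitePair i b' c = 0 := by
  have h := sitePair_mul_swap i b c b' c
  rw [mul_comm (sitePair i b' c)] at h
  exact eq_zero_of_eq_neg h

lemma sitePair_cross {n : ℕ} (i : Fin n) : sitePair i 0 1 * sitePair i 1 0 = -vol i := by
  rw [sitePair_mul_swap, mul_comm, vol]

/-! ### Quaternionic isometries and their action on the invariant two-forms -/

lemma quatMatrix_sum {κ : Type*} (s : Finset κ) (p : κ → ℍ[ℝ]) (a b : Fin 2) :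
    quatMatrix (∑ i ∈ s, p i) a b = ∑ i ∈ s, quatMatrix (p i) a b := by
  have h := map_sum (coord (0 : Fin 1) a b) (fun i _ => p i) s
  simp only [coord_apply, Finset.sum_apply] at h
  exact h

/-- The matrix of the standard symplectic form on `ℂ²`. -/
def symplMatrix : Matrix (Fin 2) (Fin 2) ℂ := !![0, 1; -1, 0]

/-- With `M` the matrix of `p` and `J` the symplectic matrix, this is `Mᵀ J = J adj(M)`, where
`adj(M)` is the matrix of `star p`. It is what links the contraction of row indices to `K`. -/
lemma quatMatrix_star_mul (p q : ℍ[ℝ]) (b c : Fin 2) :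
    quatMatrix p 0 b * quatMatrix q 1 c - quatMatrix p 1 b * quatMatrix q 0 c =
      (symplMatrix * quatMatrix (star p * q)) b c := by
  fin_cases b <;> fin_cases c <;>
    simp [quatMatrix, symplMatrix, Matrix.mul_apply, Complex.ext_iff] <;> constructor <;> ring

/-- The alternating bilinear form underlying `G n b c`, in terms of `K`. -/
lemma sum_coord_eq_K {n : ℕ} (b c : Fin 2) (v w : Hn n) :
    ∑ i, (coord i 0 b v * coord i 1 c w - coord i 0 b w * coord i 1 c v) +
        ∑ i, (coord i 0 c v * coord i 1 b w - coord i 0 c w * coord i 1 b v) =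
      (symplMatrix * quatMatrix (K v w)) b c + (symplMatrix * quatMatrix (K v w)) c b := by
  have h (b c : Fin 2) : (symplMatrix * quatMatrix (K v w)) b c =
      ∑ i, (coord i 0 b v * coord i 1 c w - coord i 1 b v * coord i 0 c w) := by
    simp only [coord_apply, quatMatrix_star_mul, K, Matrix.mul_apply, quatMatrix_sum,
      Finset.mul_sum]
    rw [Finset.sum_comm]
  rw [h, h, ← Finset.sum_add_distrib, ← Finset.sum_add_distrib]
  exact Finset.sum_congr rfl fun i _ => by ring

lemma coe_G (n : ℕ) (b c : Fin 2) :
    (G n b c : Forms n) = ∑ k : Fin n ⊕ Fin n,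
      ExteriorAlgebra.ι ℂ (Sum.elim (fun i => coord i 0 b) (fun i => coord i 0 c) k) *
        ExteriorAlgebra.ι ℂ (Sum.elim (fun i => coord i 1 c) (fun i => coord i 1 b) k) := by
  rw [Fintype.sum_sum_type, ← Finset.sum_add_distrib, G, map_sum]
  simp only [tau, map_add]
  rfl

/-- The underlying real-linear map of a quaternionic isometric embedding. -/
abbrev IsoEmb.real {m n : ℕ} (f : IsoEmb m n) : Hn m →ₗ[ℝ] Hn n := f.toLin.restrictScalars ℝ

/-- A two-form is determined by its values on pairs of vectors, and those of `G` are functions of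
`K`, which `f` preserves. -/
lemma IsoEmb.pullback_G {m n : ℕ} (f : IsoEmb m n) (b c : Fin 2) :
    pullback f.real (G n b c : Forms n) = G m b c := by
  rw [coe_G, coe_G, map_sum]
  simp only [map_mul, pullback_ι]
  refine sum_ι_mul_ι_eq _ _ _ _ fun v w => ?_
  simp only [Fintype.sum_sum_type, Sum.elim_inl, Sum.elim_inr]
  rw [sum_coord_eq_K, ← f.preserves, ← sum_coord_eq_K]
  rfl

lemma K_self_eq_zero {n : ℕ} {v : Hn n} (h : K v v = 0) : v = 0 := by
  have h1 : ∑ i, Quaternion.normSq (v i) = 0 := by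
    refine (algebraMap ℝ ℍ[ℝ]).injective ?_
    rw [map_sum, map_zero, ← h]
    exact Finset.sum_congr rfl fun i _ => (Quaternion.star_mul_self (v i)).symm
  funext i
  have := (Finset.sum_eq_zero_iff_of_nonneg fun i _ => Quaternion.normSq_nonneg).1 h1 i
    (Finset.mem_univ i)
  exact Quaternion.normSq_eq_zero.1 this

lemma IsoEmb.injective {m n : ℕ} (f : IsoEmb m n) : Function.Injective f.toLin := by
  refine (injective_iff_map_eq_zero _).2 fun v hv => K_self_eq_zero ?_
  rw [← f.preserves, hv]
  simp [K]

/-- The forms on `ℍ^n`, of all degrees, invariant under all quaternionic isometries. -/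
def invariants (n : ℕ) : Subalgebra ℂ (Forms n) where
  carrier := {ω | ∀ f : IsoEmb n n, pullback f.real ω = ω}
  mul_mem' ha hb f := by rw [map_mul, ha f, hb f]
  add_mem' ha hb f := by rw [map_add, ha f, hb f]
  algebraMap_mem' r f := AlgHom.commutes _ _

/-- An isometric endomorphism is injective, hence bijective by finite dimension over `ℝ`; so
invariance under `Sp n` and under `IsoEmb n n` agree, and no inverses need be exhibited later. -/
lemma mem_invForms_iff {n k : ℕ} {ω : Forms n} :
    ω ∈ (invForms n k).toSubmodule ↔ ω ∈ FormsDeg n k ∧ ω ∈ invariants n := by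
  constructor
  · rintro ⟨h1, h2⟩
    refine ⟨h1, fun f => ?_⟩
    have hs : Function.Surjective f.toLin :=
      (LinearMap.injective_iff_surjective (f := f.real)).1 f.injective
    exact h2 (LinearEquiv.ofBijective f.toLin ⟨f.injective, hs⟩) f.preserves
  · rintro ⟨h1, h2⟩
    exact ⟨h1, fun g hg => h2 ⟨g.toLinearMap, hg⟩⟩

/-- The three generators of the algebra of invariant forms. -/
def gen (n : ℕ) : Fin 3 → Z n := ![G n 0 0, G n 0 1, G n 1 1]

/-- Evaluation of polynomials at the three generators, in the centre. -/
def evZ (n : ℕ) : MvPolynomial (Fin 3) ℂ →ₐ[ℂ] Z n := MvPolynomial.aeval (gen n)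

/-- Evaluation of polynomials at the three generators. -/
def ev (n : ℕ) : MvPolynomial (Fin 3) ℂ →ₐ[ℂ] Forms n := (Z.val n).comp (evZ n)

lemma ev_apply (n : ℕ) (p : MvPolynomial (Fin 3) ℂ) : ev n p = (evZ n p : Forms n) := rfl

lemma ev_X (n : ℕ) (k : Fin 3) : ev n (MvPolynomial.X k) = gen n k := by
  rw [ev_apply, evZ, MvPolynomial.aeval_X]

lemma IsoEmb.pullback_gen {m n : ℕ} (f : IsoEmb m n) (k : Fin 3) :
    pullback f.real (gen n k : Forms n) = gen m k := by
  fin_cases k <;> exact f.pullback_G _ _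

lemma IsoEmb.pullback_ev {m n : ℕ} (f : IsoEmb m n) (p : MvPolynomial (Fin 3) ℂ) :
    pullback f.real (ev n p) = ev m p := by
  have : (pullback f.real).comp (ev n) = ev m := by
    refine MvPolynomial.algHom_ext fun k => ?_
    rw [AlgHom.comp_apply, ev_X, ev_X, f.pullback_gen]
  exact DFunLike.congr_fun this p

lemma ev_mem_invariants (n : ℕ) (p : MvPolynomial (Fin 3) ℂ) : ev n p ∈ invariants n :=
  fun f => f.pullback_ev p

/-! ### Special isometries -/

/-- Left multiplication by a unit quaternion in one coordinate. -/
def leftMulAt {n : ℕ} (j : Fin n) (q : ℍ[ℝ]) (hq : star q * q = 1) : IsoEmb n n where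
  toLin :=
    { toFun := fun v => Function.update v j (q * v j)
      map_add' := fun v w => by
        funext k
        rcases eq_or_ne k j with rfl | h
        · simp [mul_add]
        · simp [h]
      map_smul' := fun c v => by
        funext k
        rcases eq_or_ne k j with rfl | h
        · simp [mul_assoc]
        · simp [h] }
  preserves v w := by
    refine Finset.sum_congr rfl fun k _ => ?_
    rcases eq_or_ne k j with rfl | h
    · have : star (q * v k) * (q * w k) = star (v k) * (star q * q) * w k := by
        simp only [star_mul, mul_assoc]
      simp only [LinearMap.coe_mk, AddHom.coe_mk, Function.update_self, this, hq, mul_one]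
    · simp [h]

/-- A permutation of the coordinates. -/
def permute {n : ℕ} (σ : Equiv.Perm (Fin n)) : IsoEmb n n where
  toLin :=
    { toFun := fun v => v ∘ σ
      map_add' := fun _ _ => rfl
      map_smul' := fun _ _ => rfl }
  preserves v w := Equiv.sum_comp σ (fun i => star (v i) * w i)

/-- An isometry of the last `n` coordinates of `ℍ^{n+1}`. -/
def extend {n : ℕ} (g : IsoEmb n n) : IsoEmb (n + 1) (n + 1) where
  toLin :=
    { toFun := fun v => Fin.cons (v 0) (g.toLin (Fin.tail v))
      map_add' := fun v w => by
        funext k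
        have : Fin.tail (v + w) = Fin.tail v + Fin.tail w := rfl
        refine Fin.cases ?_ (fun k => ?_) k <;> simp [this]
      map_smul' := fun c v => by
        funext k
        have : Fin.tail (c • v) = c • Fin.tail v := rfl
        refine Fin.cases ?_ (fun k => ?_) k <;> simp [this] }
  preserves v w := by
    have := g.preserves (Fin.tail v) (Fin.tail w)
    simp only [K, Fin.sum_univ_succ, LinearMap.coe_mk, AddHom.coe_mk, Fin.cons_zero,
      Fin.cons_succ] at this ⊢
    rw [this]
    rfl

/-- The inclusion of `ℍ^n` in `ℍ^{n+1}` as the last `n` coordinates. -/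
def inclTail (n : ℕ) : IsoEmb n (n + 1) where
  toLin :=
    { toFun := fun v => Fin.cons 0 v
      map_add' := fun v w => by
        funext k
        refine Fin.cases ?_ (fun k => ?_) k <;> simp
      map_smul' := fun c v => by
        funext k
        refine Fin.cases ?_ (fun k => ?_) k <;> simp }
  preserves v w := by simp [K, Fin.sum_univ_succ]

/-- The projection of `ℍ^{n+1}` onto the last `n` coordinates. -/
def projTail (n : ℕ) : Hn (n + 1) →ₗ[ℝ] Hn n := LinearMap.funLeft ℝ _ Fin.succ

/-- The rotation by `π / 4` in the plane of two coordinates. -/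
def rotate {n : ℕ} (i j : Fin n) (hij : i ≠ j) : IsoEmb n n where
  toLin :=
    { toFun := fun v => Function.update (Function.update v i ((√2)⁻¹ • (v i + v j))) j
        ((√2)⁻¹ • (v i - v j))
      map_add' := fun v w => by
        funext k
        rcases eq_or_ne k j with rfl | h
        · simp [smul_add, smul_sub]; abel
        · rcases eq_or_ne k i with rfl | h'
          · simp [h, smul_add]; abel
          · simp [h, h']
      map_smul' := fun c v => by
        funext k
        rcases eq_or_ne k j with rfl | h
        · simp [smul_sub]
        · rcases eq_or_ne k i with rfl | h'
          · simp [h]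
          · simp [h, h'] }
  preserves v w := by
    have hs : (√2)⁻¹ * (√2)⁻¹ = (1 / 2 : ℝ) := by
      rw [← mul_inv, Real.mul_self_sqrt zero_le_two, one_div]
    simp only [K, LinearMap.coe_mk, AddHom.coe_mk]
    rw [← Finset.add_sum_erase _ _ (Finset.mem_univ j),
      ← Finset.add_sum_erase _ _ (Finset.mem_univ j),
      ← Finset.add_sum_erase _ _ (Finset.mem_erase.2 ⟨hij, Finset.mem_univ i⟩),
      ← Finset.add_sum_erase _ _ (Finset.mem_erase.2 ⟨hij, Finset.mem_univ i⟩),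
      ← add_assoc, ← add_assoc]
    congr 1
    · simp only [Function.update_self, Function.update_of_ne hij, Quaternion.star_smul,
        smul_mul_smul_comm, hs, star_add, star_sub]
      simp only [mul_add, mul_sub, add_mul, sub_mul, smul_add, smul_sub]
      module
    · refine Finset.sum_congr rfl fun k hk => ?_
      simp only [Finset.mem_erase] at hk
      simp [hk.1, hk.2.1]

/-- The quaternion unit `i`. -/
def unitI : ℍ[ℝ] := ⟨0, 1, 0, 0⟩

/-- The quaternion unit `j`. -/
def unitJ : ℍ[ℝ] := ⟨0, 0, 1, 0⟩

/-- The quaternion unit `k`. -/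
def unitK : ℍ[ℝ] := ⟨0, 0, 0, 1⟩

section Units

@[simp] lemma unitI_re : unitI.re = 0 := rfl
@[simp] lemma unitI_imI : unitI.imI = 1 := rfl
@[simp] lemma unitI_imJ : unitI.imJ = 0 := rfl
@[simp] lemma unitI_imK : unitI.imK = 0 := rfl
@[simp] lemma unitJ_re : unitJ.re = 0 := rfl
@[simp] lemma unitJ_imI : unitJ.imI = 0 := rfl
@[simp] lemma unitJ_imJ : unitJ.imJ = 1 := rfl
@[simp] lemma unitJ_imK : unitJ.imK = 0 := rfl
@[simp] lemma unitK_re : unitK.re = 0 := rfl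
@[simp] lemma unitK_imI : unitK.imI = 0 := rfl
@[simp] lemma unitK_imJ : unitK.imJ = 0 := rfl
@[simp] lemma unitK_imK : unitK.imK = 1 := rfl

end Units

/-! ### Expansion of a form along the first coordinate -/

/-- The inclusion of `ℍ` in `ℍ^{n+1}` as the first coordinate. -/
def siteVec (n : ℕ) (q : ℍ[ℝ]) : Hn (n + 1) := Fin.cons q 0

@[simp] lemma siteVec_zero (n : ℕ) (q : ℍ[ℝ]) : siteVec n q 0 = q := rfl

@[simp] lemma siteVec_succ (n : ℕ) (q : ℍ[ℝ]) (i : Fin n) : siteVec n q i.succ = 0 := rfl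

/-- The functionals on covectors dual to the four coordinates at the first site. -/
def siteDual (n : ℕ) (a b : Fin 2) : Module.Dual ℂ (Hn (n + 1) →ₗ[ℝ] ℂ) where
  toFun φ := (1 / 2) *
    (!![φ (siteVec n 1) - Complex.I * φ (siteVec n unitI),
        -φ (siteVec n unitJ) + Complex.I * φ (siteVec n unitK);
        φ (siteVec n unitJ) + Complex.I * φ (siteVec n unitK),
        φ (siteVec n 1) + Complex.I * φ (siteVec n unitI)] a b)
  map_add' φ ψ := by fin_cases a <;> fin_cases b <;> simp <;> ring
  map_smul' c φ := by fin_cases a <;> fin_cases b <;> simp <;> ring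

lemma siteDual_coord_zero (n : ℕ) (a b a' b' : Fin 2) :
    siteDual n a b (coord 0 a' b') = if a = a' ∧ b = b' then 1 else 0 := by
  fin_cases a <;> fin_cases b <;> fin_cases a' <;> fin_cases b' <;>
    simp [siteDual, coord_apply, quatMatrix, Complex.ext_iff] <;> norm_num

lemma siteDual_coord_succ (n : ℕ) (a b a' b' : Fin 2) (i : Fin n) :
    siteDual n a b (coord i.succ a' b') = 0 := by
  fin_cases a <;> fin_cases b <;> fin_cases a' <;> fin_cases b' <;>
    simp [siteDual, coord_apply, quatMatrix, Complex.ext_iff]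

/-- Split `v` into its tail and its first entry, expand the latter in `1, i, j, k`, and pass from
these real coordinates to the four matrix entries. -/
lemma covector_eq_site_add (n : ℕ) (φ : Hn (n + 1) →ₗ[ℝ] ℂ) (v : Hn (n + 1)) :
    φ v = φ ((inclTail n).real (projTail n v)) +
      ∑ a, ∑ b, siteDual n a b φ * coord 0 a b v := by
  have hv : v = (inclTail n).real (projTail n v) + ((v 0).re • siteVec n 1 +
      (v 0).imI • siteVec n unitI + (v 0).imJ • siteVec n unitJ +
      (v 0).imK • siteVec n unitK) := by
    funext k
    refine Fin.cases ?_ (fun k => ?_) k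
    · ext <;> simp [inclTail]
    · simp [inclTail, projTail, LinearMap.funLeft]
  conv_lhs => rw [hv]
  simp only [map_add, map_smul, Fin.sum_univ_two, coord_apply, siteDual, LinearMap.coe_mk,
    AddHom.coe_mk]
  generalize φ (siteVec n 1) = p
  generalize φ (siteVec n unitI) = q
  generalize φ (siteVec n unitJ) = r
  generalize φ (siteVec n unitK) = s
  congr 1
  simp [quatMatrix, Complex.ext_iff]
  constructor <;> ring

lemma siteDual_extend {n : ℕ} (g : IsoEmb n n) (a b : Fin 2) :
    siteDual n a b ∘ₗ LinearMap.lcomp ℂ ℂ (extend g).real = siteDual n a b := by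
  have h (q : ℍ[ℝ]) : (extend g).real (siteVec n q) = siteVec n q := by
    have h0 : Fin.tail (siteVec n q) = 0 := rfl
    funext k
    refine Fin.cases ?_ (fun k => ?_) k <;> simp [extend, h0]
  refine LinearMap.ext fun φ => ?_
  simp only [siteDual, LinearMap.comp_apply, LinearMap.coe_mk, AddHom.coe_mk,
    LinearMap.lcomp_apply', h]

lemma contract_pullback_extend {n : ℕ} (g : IsoEmb n n) (a b : Fin 2) (ω : Forms (n + 1)) :
    contract (siteDual n a b) (pullback (extend g).real ω) =
      pullback (extend g).real (contract (siteDual n a b) ω) := by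
  rw [pullback, contract_map, siteDual_extend]

lemma pullback_extend_dz {n : ℕ} (g : IsoEmb n n) (a b : Fin 2) :
    pullback (extend g).real (dz 0 a b) = dz 0 a b := by
  rw [pullback_dz]; rfl

/-- The covector map dual to the projection that kills the first coordinate is the product of the
four maps `φ ↦ φ - d(φ) e`, one for each coordinate at the site; each fixes a form killed by the
contraction with `d`. -/
lemma pullback_projTail_inclTail (n : ℕ) {ω : Forms (n + 1)}
    (h : ∀ a b, contract (siteDual n a b) ω = 0) :
    pullback (projTail n) (pullback (inclTail n).real ω) = ω := by
  have hE (a b : Fin 2) : ExteriorAlgebra.map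
      (LinearMap.id - (siteDual n a b).smulRight (coord 0 a b)) ω = ω := by
    rw [map_id_sub_smulRight, h, mul_zero, sub_zero]
  have hcomp : LinearMap.lcomp ℂ ℂ ((inclTail n).real ∘ₗ projTail n) =
      (LinearMap.id - (siteDual n 0 0).smulRight (coord 0 0 0)) ∘ₗ
      (LinearMap.id - (siteDual n 0 1).smulRight (coord 0 0 1)) ∘ₗ
      (LinearMap.id - (siteDual n 1 0).smulRight (coord 0 1 0)) ∘ₗ
      (LinearMap.id - (siteDual n 1 1).smulRight (coord 0 1 1)) := by
    refine LinearMap.ext fun φ => LinearMap.ext fun v => ?_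
    rw [LinearMap.lcomp_apply', LinearMap.comp_apply, LinearMap.comp_apply,
      ← sub_eq_iff_eq_add.2 (covector_eq_site_add n φ v)]
    simp [siteDual_coord_zero, Fin.sum_univ_two]
    ring
  rw [pullback_comp, pullback, hcomp, ← ExteriorAlgebra.map_comp_map,
    ← ExteriorAlgebra.map_comp_map, ← ExteriorAlgebra.map_comp_map]
  simp only [AlgHom.comp_apply, hE]

/-- Forms on `ℍ^{n+1}` invariant under the isometries of the last `n` coordinates and killed by
the contractions with the coordinates in `s`. -/
def IsReduced {n : ℕ} (s : Set (Fin 2 × Fin 2)) (ω : Forms (n + 1)) : Prop :=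
  (∀ g : IsoEmb n n, pullback (extend g).real ω = ω) ∧
    ∀ p ∈ s, contract (siteDual n p.1 p.2) ω = 0

/-- Take `β` to be the contraction of `ω` and `α = ω - dz 0 a b * β`. Contractions square to zero,
anticommute, and commute with the isometries of the tail, so both pieces stay reduced. -/
lemma IsReduced.exists_eq_add {n : ℕ} {s : Set (Fin 2 × Fin 2)} {ω : Forms (n + 1)}
    (h : IsReduced s ω) (a b : Fin 2) (hs : (a, b) ∉ s) :
    ∃ α β, IsReduced (insert (a, b) s) α ∧ IsReduced (insert (a, b) s) β ∧
      ω = α + dz 0 a b * β := by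
  have hβ : IsReduced (insert (a, b) s) (contract (siteDual n a b) ω) := by
    refine ⟨fun g => ?_, ?_⟩
    · rw [← contract_pullback_extend, h.1]
    · rintro p (rfl | hp)
      · exact contract_contract _ _
      · rw [contract_comm, h.2 p hp, map_zero, neg_zero]
  refine ⟨ω - dz 0 a b * contract (siteDual n a b) ω, _, ⟨fun g => ?_, ?_⟩, hβ, by abel⟩
  · rw [map_sub, map_mul, pullback_extend_dz, hβ.1, h.1]
  · rintro p hp
    rw [map_sub, dz, contract_ι_mul, hβ.2 p hp, mul_zero, sub_zero, siteDual_coord_zero]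
    rcases hp with rfl | hp
    · simp
    · have : ¬ (p.1 = a ∧ p.2 = b) := by
        rintro ⟨rfl, rfl⟩
        exact hs hp
      rw [h.2 p hp, if_neg this, zero_smul, sub_zero]

lemma IsReduced.exists_eq_pullback {n : ℕ} {s : Set (Fin 2 × Fin 2)} {ω : Forms (n + 1)}
    (h : IsReduced s ω) (hs : ∀ p, p ∈ s) :
    ∃ w ∈ invariants n, ω = pullback (projTail n) w := by
  refine ⟨pullback (inclTail n).real ω, fun g => ?_,
    (pullback_projTail_inclTail n fun a b => h.2 (a, b) (hs _)).symm⟩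
  have : (inclTail n).real ∘ₗ g.real = (extend g).real ∘ₗ (inclTail n).real := by
    refine LinearMap.ext fun v => funext fun k => ?_
    refine Fin.cases ?_ (fun k => ?_) k <;> simp [inclTail, extend]
  rw [pullback_comp, this, ← pullback_comp, h.1]

/-- The monomials in the coordinate one-forms of a site. -/
def siteMono {n : ℕ} (i : Fin n) (r s t u : ℕ) : Forms n :=
  dz i 0 0 ^ r * dz i 1 0 ^ s * dz i 0 1 ^ t * dz i 1 1 ^ u

/-- An invariant form is a combination of monomials at the first site with coefficients pulled
back from invariant forms in one dimension less. -/
lemma mem_of_siteMono_mul_mem {n : ℕ} (U : Submodule ℂ (Forms (n + 1)))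
    (hU : ∀ r s t u, r < 2 → s < 2 → t < 2 → u < 2 → ∀ w ∈ invariants n,
      siteMono 0 r s t u * pullback (projTail n) w ∈ U)
    {ω : Forms (n + 1)} (hω : ω ∈ invariants (n + 1)) : ω ∈ U := by
  -- Peels off one coordinate form: the exponents `k = 0` and `k = 1` account for `α` and `β`, and
  -- `m` collects the factors already removed.
  have step {s : Set (Fin 2 × Fin 2)} (a b : Fin 2) (hs : (a, b) ∉ s) (m : Forms (n + 1))
      (h : ∀ k < 2, ∀ ω, IsReduced (insert (a, b) s) ω → m * dz 0 a b ^ k * ω ∈ U) :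
      ∀ ω, IsReduced s ω → m * ω ∈ U := by
    intro ω hω
    obtain ⟨α, β, hα, hβ, rfl⟩ := hω.exists_eq_add a b hs
    have h0 := h 0 zero_lt_two α hα
    have h1 := h 1 one_lt_two β hβ
    rw [pow_zero, mul_one] at h0
    rw [pow_one, mul_assoc] at h1
    rw [mul_add]
    exact add_mem h0 h1
  have h0 : IsReduced ∅ ω := ⟨fun g => hω _, by simp⟩
  rw [← one_mul ω]
  refine step 0 0 (by simp) 1 (fun r hr => ?_) ω h0
  refine step 1 0 (by simp) _ (fun s hs => ?_)
  refine step 0 1 (by simp) _ (fun t ht => ?_)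
  refine step 1 1 (by simp) _ (fun u hu => ?_)
  intro ω hω
  obtain ⟨w, hw, rfl⟩ := hω.exists_eq_pullback (by decide +revert)
  rw [one_mul]
  exact hU r s t u hr hs ht hu w hw

/-! ### Averaging over a finite group of left multiplications at one site -/

/-- Pullback along the left multiplication by `i` at a site. -/
def pullI {n : ℕ} (k : Fin n) : Forms n →ₐ[ℂ] Forms n :=
  pullback (leftMulAt k unitI (by ext <;> simp)).real

/-- Pullback along the left multiplication by `j` at a site. -/
def pullJ {n : ℕ} (k : Fin n) : Forms n →ₐ[ℂ] Forms n :=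
  pullback (leftMulAt k unitJ (by ext <;> simp)).real

/-- The average over the left multiplications by `j^a i^b` at a site. -/
def siteAvg {n : ℕ} (k : Fin n) : Forms n →ₗ[ℂ] Forms n :=
  (1 / 8 : ℂ) • ((1 + (pullJ k).toLinearMap) *
    (1 + (pullI k).toLinearMap + (pullI k).toLinearMap ^ 2 + (pullI k).toLinearMap ^ 3))

lemma siteAvg_apply {n : ℕ} (k : Fin n) (ω : Forms n) :
    siteAvg k ω = (1 / 8 : ℂ) •
      ((ω + pullI k ω + pullI k (pullI k ω) + pullI k (pullI k (pullI k ω))) +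
        pullJ k (ω + pullI k ω + pullI k (pullI k ω) + pullI k (pullI k (pullI k ω)))) := rfl

lemma siteAvg_of_mem {n : ℕ} (k : Fin n) {ω : Forms n} (h : ω ∈ invariants n) :
    siteAvg k ω = ω := by
  have hI : pullI k ω = ω := h _
  have hJ : pullJ k ω = ω := h _
  rw [siteAvg_apply]
  simp only [hI, map_add, hJ]
  module

/-- Pullbacks are multiplicative, so the average is linear over the forms fixed by both of them. -/
lemma siteAvg_mul {n : ℕ} (k : Fin n) (α : Forms n) {ω : Forms n} (hI : pullI k ω = ω)
    (hJ : pullJ k ω = ω) : siteAvg k (α * ω) = siteAvg k α * ω := by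
  simp only [siteAvg_apply, map_mul, map_add, hI, hJ, smul_mul_assoc, add_mul]

lemma mul_siteAvg {n : ℕ} (k : Fin n) (α : Forms n) {ω : Forms n} (hI : pullI k ω = ω)
    (hJ : pullJ k ω = ω) : siteAvg k (ω * α) = ω * siteAvg k α := by
  simp only [siteAvg_apply, map_mul, map_add, hI, hJ, mul_smul_comm, mul_add]

lemma siteAvg_of_eigen {n : ℕ} (k : Fin n) {ω : Forms n} {c : ℂ} (h : pullI k ω = c • ω)
    (hc : 1 + c + c ^ 2 + c ^ 3 = 0) : siteAvg k ω = 0 := by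
  have : ω + pullI k ω + pullI k (pullI k ω) + pullI k (pullI k (pullI k ω)) = 0 := by
    simp only [h, map_smul]
    have : ω + c • ω + c • c • ω + c • c • c • ω = (1 + c + c ^ 2 + c ^ 3) • ω := by module
    rw [this, hc, zero_smul]
  rw [siteAvg_apply, this, map_zero, add_zero, smul_zero]

lemma siteAvg_of_fixed {n : ℕ} (k : Fin n) {ω : Forms n} (h : pullI k ω = ω) :
    siteAvg k ω = (1 / 2 : ℂ) • (ω + pullJ k ω) := by
  rw [siteAvg_apply]
  simp only [h, map_add]
  module

lemma pullI_dz_self {n : ℕ} (k : Fin n) (a b : Fin 2) :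
    pullI k (dz k a b) = (if a = 0 then Complex.I else -Complex.I) • dz k a b := by
  rw [pullI, pullback_dz, dz, ← map_smul]
  congr 1
  refine LinearMap.ext fun v => ?_
  fin_cases a <;> fin_cases b <;>
    simp [leftMulAt, coord_apply, quatMatrix, Complex.ext_iff]

lemma pullJ_dz_zero {n : ℕ} (k : Fin n) (b : Fin 2) :
    pullJ k (dz k 0 b) = -dz k 1 b := by
  rw [pullJ, pullback_dz, dz, ← map_neg]
  congr 1
  refine LinearMap.ext fun v => ?_
  fin_cases b <;> simp [leftMulAt, coord_apply, quatMatrix, Complex.ext_iff]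

lemma pullJ_dz_one {n : ℕ} (k : Fin n) (b : Fin 2) :
    pullJ k (dz k 1 b) = dz k 0 b := by
  rw [pullJ, pullback_dz, dz]
  congr 1
  refine LinearMap.ext fun v => ?_
  fin_cases b <;> simp [leftMulAt, coord_apply, quatMatrix, Complex.ext_iff]

lemma pullback_leftMulAt_dz_ne {n : ℕ} {i k : Fin n} (h : i ≠ k) (q : ℍ[ℝ]) (hq)
    (a b : Fin 2) : pullback (leftMulAt k q hq).real (dz i a b) = dz i a b := by
  rw [pullback_dz, dz]
  congr 1
  refine LinearMap.ext fun v => ?_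
  simp [leftMulAt, coord_apply, h]

lemma pullback_leftMulAt_projTail {n : ℕ} (q : ℍ[ℝ]) (hq) (w : Forms n) :
    pullback (leftMulAt 0 q hq).real (pullback (projTail n) w) = pullback (projTail n) w := by
  rw [pullback_comp]
  congr 2

/-! ### The first fundamental theorem: reduction to one site -/

lemma coe_sitePair {n : ℕ} (i : Fin n) (b c : Fin 2) :
    (sitePair i b c : Forms n) = dz i 0 b * dz i 1 c := rfl

lemma coe_tau {n : ℕ} (i : Fin n) (b c : Fin 2) :
    (tau i b c : Forms n) = sitePair i b c + sitePair i c b := map_add _ _ _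

lemma coe_vol {n : ℕ} (i : Fin n) :
    (vol i : Forms n) = sitePair i 0 0 * sitePair i 1 1 := map_mul _ _ _

lemma tau_symm {n : ℕ} (i : Fin n) (b c : Fin 2) : tau i b c = tau i c b := add_comm _ _

lemma pullI_sitePair {n : ℕ} (k : Fin n) (b c : Fin 2) :
    pullI k (sitePair k b c : Forms n) = sitePair k b c := by
  rw [coe_sitePair, map_mul, pullI_dz_self, pullI_dz_self, smul_mul_smul_comm]
  simp

lemma pullJ_sitePair {n : ℕ} (k : Fin n) (b c : Fin 2) :
    pullJ k (sitePair k b c : Forms n) = sitePair k c b := by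
  rw [coe_sitePair, map_mul, pullJ_dz_zero, pullJ_dz_one, coe_sitePair, neg_mul,
    dz_swap k k 1 b 0 c, neg_neg]

lemma siteAvg_sitePair {n : ℕ} (k : Fin n) (b c : Fin 2) :
    siteAvg k (sitePair k b c : Forms n) = (1 / 2 : ℂ) • (tau k b c : Forms n) := by
  rw [siteAvg_of_fixed k (pullI_sitePair k b c), pullJ_sitePair, coe_tau]

lemma siteAvg_vol {n : ℕ} (k : Fin n) : siteAvg k (vol k : Forms n) = vol k := by
  have h : pullI k (vol k : Forms n) = vol k := by
    rw [coe_vol, map_mul, pullI_sitePair, pullI_sitePair]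
  have h' : pullJ k (vol k : Forms n) = vol k := by
    rw [coe_vol, map_mul, pullJ_sitePair, pullJ_sitePair]
  rw [siteAvg_of_fixed k h, h']
  module

lemma siteAvg_one {n : ℕ} (k : Fin n) : siteAvg k (1 : Forms n) = 1 :=
  siteAvg_of_mem k (one_mem _)

lemma siteAvg_dz_mul_dz {n : ℕ} (k : Fin n) (a b c : Fin 2) :
    siteAvg k (dz k a b * dz k a c) = 0 := by
  refine siteAvg_of_eigen k (c := -1) ?_ (by norm_num)
  rw [map_mul, pullI_dz_self, pullI_dz_self, smul_mul_smul_comm]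
  fin_cases a <;> simp

/-- The averages of the invariants of the first site. -/
def siteElt (n : ℕ) : Fin 5 → Z (n + 1) := ![1, tau 0 0 0, tau 0 0 1, tau 0 1 1, vol 0]

lemma siteAvg_siteMono {n : ℕ} {r s t u : ℕ} (hr : r < 2) (hs : s < 2) (ht : t < 2)
    (hu : u < 2) : ∃ (k : Fin 5) (c : ℂ),
      siteAvg 0 (siteMono (0 : Fin (n + 1)) r s t u) = c • (siteElt n k : Forms (n + 1)) := by
  have hI (c : ℂ) (hc : 1 + c + c ^ 2 + c ^ 3 = 0)
      (h : pullI 0 (siteMono (0 : Fin (n + 1)) r s t u) = c • siteMono 0 r s t u) :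
      ∃ (k : Fin 5) (c : ℂ), siteAvg 0 (siteMono (0 : Fin (n + 1)) r s t u) =
        c • (siteElt n k : Forms (n + 1)) :=
    ⟨0, 0, by rw [siteAvg_of_eigen 0 h hc, zero_smul]⟩
  have e1 : 1 + Complex.I + Complex.I ^ 2 + Complex.I ^ 3 = 0 := by
    rw [pow_succ Complex.I 2, Complex.I_sq]; ring
  have e2 : 1 + -Complex.I + (-Complex.I) ^ 2 + (-Complex.I) ^ 3 = 0 := by
    rw [pow_succ (-Complex.I) 2, neg_sq, Complex.I_sq]; ring
  have e3 : (1 : ℂ) + -1 + (-1) ^ 2 + (-1) ^ 3 = 0 := by norm_num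
  -- Under `pullI` a row-0 form has eigenvalue `i` and a row-1 form `-i`. A monomial with unequal
  -- numbers of the two has eigenvalue `i`, `-i` or `-1` and averages to zero; there the index
  -- chosen in `hI` is immaterial. Six balanced monomials remain, and `pullJ` symmetrises them to
  -- the five site elements.
  interval_cases r <;> interval_cases s <;> interval_cases t <;> interval_cases u <;>
    simp only [siteMono, pow_zero, pow_one, one_mul, mul_one] at hI ⊢
  · exact ⟨0, 1, by rw [siteAvg_one, one_smul]; exact (map_one _).symm⟩
  · exact hI _ e2 (by simp [pullI_dz_self])
  · exact hI _ e1 (by simp [pullI_dz_self])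
  · exact ⟨3, 1 / 2, by rw [← coe_sitePair, siteAvg_sitePair]; rfl⟩
  · exact hI _ e2 (by simp [pullI_dz_self])
  · exact hI _ e3 (by simp [pullI_dz_self, smul_smul])
  · refine ⟨2, -(1 / 2), ?_⟩
    rw [dz_swap (0 : Fin (n + 1)), map_neg, ← coe_sitePair, siteAvg_sitePair, neg_smul, tau_symm]; rfl
  · exact hI _ e2 (by simp [pullI_dz_self, smul_smul])
  · exact hI _ e1 (by simp [pullI_dz_self])
  · exact ⟨2, 1 / 2, by rw [← coe_sitePair, siteAvg_sitePair]; rfl⟩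
  · exact hI _ e3 (by simp [pullI_dz_self, smul_smul])
  · exact hI _ e1 (by simp [pullI_dz_self, smul_smul])
  · exact ⟨1, 1 / 2, by rw [← coe_sitePair, siteAvg_sitePair]; rfl⟩
  · exact hI _ e2 (by simp [pullI_dz_self, smul_smul])
  · exact hI _ e1 (by simp [pullI_dz_self, smul_smul])
  · refine ⟨4, 1, ?_⟩
    have : dz (0 : Fin (n + 1)) 0 0 * dz 0 1 0 * dz 0 0 1 * dz 0 1 1 =
        Z.val (n + 1) (vol 0) := by
      rw [coe_vol, coe_sitePair, coe_sitePair, mul_assoc _ (dz 0 0 1)]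
    rw [this, siteAvg_vol, one_smul]; rfl

/-- The span of the site elements over the polynomials in the generators. -/
def siteSpan (n : ℕ) : Submodule ℂ (Z (n + 1)) :=
  LinearMap.range (∑ k : Fin 5, LinearMap.mulRight ℂ (siteElt n k) ∘ₗ
    (evZ (n + 1)).toLinearMap ∘ₗ LinearMap.proj (φ := fun _ => MvPolynomial (Fin 3) ℂ) k)

lemma mem_siteSpan {n : ℕ} {z : Z (n + 1)} :
    z ∈ siteSpan n ↔ ∃ p : Fin 5 → MvPolynomial (Fin 3) ℂ,
      z = ∑ k, evZ (n + 1) (p k) * siteElt n k := by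
  simp only [siteSpan, LinearMap.mem_range, LinearMap.sum_apply, LinearMap.comp_apply,
    LinearMap.proj_apply, LinearMap.mulRight_apply, AlgHom.toLinearMap_apply, eq_comm]

lemma siteElt_mem (n : ℕ) (k : Fin 5) : siteElt n k ∈ siteSpan n := by
  refine mem_siteSpan.2 ⟨Pi.single k 1, ?_⟩
  rw [Finset.sum_eq_single k]
  · simp
  · intro l _ h; simp [h]
  · simp

lemma evZ_mul_mem {n : ℕ} (q : MvPolynomial (Fin 3) ℂ) {z : Z (n + 1)} (hz : z ∈ siteSpan n) :
    evZ (n + 1) q * z ∈ siteSpan n := by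
  obtain ⟨p, rfl⟩ := mem_siteSpan.1 hz
  exact mem_siteSpan.2 ⟨fun k => q * p k, by simp only [Finset.mul_sum, map_mul, mul_assoc]⟩

/-- The site elements span a subalgebra: the only nonzero products of two `tau`s at a site are `tau
00 * tau 11 = 4 vol` and `tau 01 ^ 2 = -2 vol`, and `tau * vol = 0`. The last entries of the
witnesses below record these constants. -/
lemma tau_mul_mem {n : ℕ} (b c : Fin 2) {z : Z (n + 1)} (hz : z ∈ siteSpan n) :
    tau 0 b c * z ∈ siteSpan n := by
  obtain ⟨p, rfl⟩ := mem_siteSpan.1 hz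
  set s := sitePair (0 : Fin (n + 1)) 0 0 with hs
  set t := sitePair (0 : Fin (n + 1)) 0 1 with ht
  set u := sitePair (0 : Fin (n + 1)) 1 0 with hu
  set v := sitePair (0 : Fin (n + 1)) 1 1 with hv
  have hss : s * s = 0 := sitePair_mul_right _ _ _ _
  have hst : s * t = 0 := sitePair_mul_right _ _ _ _
  have hsu : s * u = 0 := sitePair_mul_left _ _ _ _
  have htt : t * t = 0 := sitePair_mul_right _ _ _ _
  have huu : u * u = 0 := sitePair_mul_right _ _ _ _
  have hvv : v * v = 0 := sitePair_mul_right _ _ _ _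
  have htv : t * v = 0 := sitePair_mul_left _ _ _ _
  have huv : u * v = 0 := sitePair_mul_right _ _ _ _
  have htu : t * u = -(s * v) := sitePair_cross _
  have key (q : Fin 5 → MvPolynomial (Fin 3) ℂ) :
      ∑ k, evZ (n + 1) (q k) * siteElt n k = evZ (n + 1) (q 0) +
        evZ (n + 1) (q 1) * (s + s) + evZ (n + 1) (q 2) * (t + u) + evZ (n + 1) (q 3) * (v + v) +
        evZ (n + 1) (q 4) * (s * v) := by
    rw [Fin.sum_univ_five]
    change _ * 1 + _ + _ + _ + _ = _
    rw [mul_one]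
    rfl
  have h00 : (s + s) * ∑ k, evZ (n + 1) (p k) * siteElt n k ∈ siteSpan n := by
    refine mem_siteSpan.2 ⟨![0, p 0, 0, 0, p 3 + p 3 + p 3 + p 3], ?_⟩
    rw [key, key]
    simp
    linear_combination (4 * evZ (n + 1) (p 1) + 2 * evZ (n + 1) (p 4) * v) * hss +
      2 * evZ (n + 1) (p 2) * (hst + hsu)
  have h01 : (t + u) * ∑ k, evZ (n + 1) (p k) * siteElt n k ∈ siteSpan n := by
    refine mem_siteSpan.2 ⟨![0, 0, p 0, 0, -(p 2 + p 2)], ?_⟩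
    rw [key, key]
    simp
    linear_combination (2 * evZ (n + 1) (p 1) + evZ (n + 1) (p 4) * v) * (hst + hsu) +
      evZ (n + 1) (p 2) * (htt + huu + 2 * htu) + 2 * evZ (n + 1) (p 3) * (htv + huv)
  have h11 : (v + v) * ∑ k, evZ (n + 1) (p k) * siteElt n k ∈ siteSpan n := by
    refine mem_siteSpan.2 ⟨![0, 0, 0, p 0, p 1 + p 1 + p 1 + p 1], ?_⟩
    rw [key, key]
    simp
    linear_combination (4 * evZ (n + 1) (p 3) + 2 * evZ (n + 1) (p 4) * s) * hvv +
      2 * evZ (n + 1) (p 2) * (htv + huv)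
  fin_cases b <;> fin_cases c
  · exact h00
  · exact h01
  · rw [tau_symm]; exact h01
  · exact h11

lemma pullback_projTail_tau {n : ℕ} (i : Fin n) (b c : Fin 2) :
    pullback (projTail n) (tau i b c : Forms n) = tau i.succ b c := by
  simp only [coe_tau, coe_sitePair, map_add, map_mul, pullback_dz]
  rfl

lemma pullback_projTail_G (n : ℕ) (b c : Fin 2) :
    pullback (projTail n) (G n b c : Forms n) = (G (n + 1) b c - tau 0 b c : Z (n + 1)) := by
  rw [G, G, Fin.sum_univ_succ, add_sub_cancel_left]
  simp only [map_sum, pullback_projTail_tau]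

lemma gen_eq_G (n : ℕ) (k : Fin 3) : gen n k = G n (![0, 0, 1] k) (![0, 1, 1] k) := by
  fin_cases k <;> rfl

/-- Multiplication by the pullback of an invariant polynomial preserves the site span. -/
lemma exists_pullback_ev_mul_mem (n : ℕ) (q : MvPolynomial (Fin 3) ℂ) :
    ∃ y : Z (n + 1), (y : Forms (n + 1)) = pullback (projTail n) (ev n q) ∧
      ∀ z ∈ siteSpan n, y * z ∈ siteSpan n := by
  induction q using MvPolynomial.induction_on with
  | C a =>
    refine ⟨algebraMap ℂ _ a, ?_, fun z hz => ?_⟩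
    · rw [← MvPolynomial.algebraMap_eq, AlgHom.commutes, AlgHom.commutes, AlgHom.commutes]
    · rw [← Algebra.smul_def]; exact Submodule.smul_mem _ _ hz
  | add p q hp hq =>
    obtain ⟨y, hy, hy'⟩ := hp
    obtain ⟨x, hx, hx'⟩ := hq
    refine ⟨y + x, ?_, fun z hz => ?_⟩
    · rw [map_add, map_add, map_add, ← hx, ← hy]
    · rw [add_mul]; exact add_mem (hy' z hz) (hx' z hz)
  | mul_X p k hp =>
    obtain ⟨y, hy, hy'⟩ := hp
    -- Pulling a generator back from the tail removes the contribution of the first site.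
    refine ⟨y * (gen (n + 1) k - tau 0 (![0, 0, 1] k) (![0, 1, 1] k)), ?_, fun z hz => ?_⟩
    · rw [map_mul, map_mul, map_mul, ev_X, gen_eq_G n, pullback_projTail_G, ← hy, gen_eq_G]
    · rw [mul_assoc]
      refine hy' _ ?_
      rw [sub_mul]
      refine sub_mem ?_ (tau_mul_mem _ _ hz)
      have : gen (n + 1) k = evZ (n + 1) (MvPolynomial.X k) := by rw [evZ, MvPolynomial.aeval_X]
      rw [this]
      exact evZ_mul_mem _ hz

/-- If invariant forms in dimension `n` are polynomials in the generators, then those in dimension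
`n + 1` are combinations of the site elements. -/
lemma invariants_le_siteSpan {n : ℕ} (ih : ∀ ω ∈ invariants n, ∃ q, ω = ev n q)
    {ω : Forms (n + 1)} (hω : ω ∈ invariants (n + 1)) :
    ∃ p : Fin 5 → MvPolynomial (Fin 3) ℂ,
      ω = ∑ k, ev (n + 1) (p k) * (siteElt n k : Forms (n + 1)) := by
  -- Membership is tested after averaging: this is linear, so it can be checked monomial by
  -- monomial, and the invariant `ω` equals its own average.
  have h : ω ∈ ((siteSpan n).map (Z.val (n + 1)).toLinearMap).comap (siteAvg 0) := by
    refine mem_of_siteMono_mul_mem _ (fun r s t u hr hs ht hu w hw => ?_) hω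
    obtain ⟨q, rfl⟩ := ih w hw
    obtain ⟨y, hy, hy'⟩ := exists_pullback_ev_mul_mem n q
    obtain ⟨k, c, hk⟩ := siteAvg_siteMono (n := n) hr hs ht hu
    rw [Submodule.mem_comap, siteAvg_mul 0 _ (pullback_leftMulAt_projTail _ _ _)
      (pullback_leftMulAt_projTail _ _ _), hk, ← hy]
    refine ⟨y * (c • siteElt n k), hy' _ (Submodule.smul_mem _ _ (siteElt_mem n k)), ?_⟩
    rw [AlgHom.toLinearMap_apply, mul_comm, map_mul, map_smul]
  rw [Submodule.mem_comap, siteAvg_of_mem 0 hω] at h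
  obtain ⟨z, hz, rfl⟩ := h
  obtain ⟨p, rfl⟩ := mem_siteSpan.1 hz
  exact ⟨p, by simp [ev_apply, AlgHom.toLinearMap_apply]⟩

/-! ### The first fundamental theorem: symmetrisation over the sites -/

lemma pullback_permute_dz {n : ℕ} (σ : Equiv.Perm (Fin n)) (i : Fin n) (a b : Fin 2) :
    pullback (permute σ).real (dz i a b) = dz (σ i) a b := by
  rw [pullback_dz]; rfl

lemma pullback_permute_tau {n : ℕ} (σ : Equiv.Perm (Fin n)) (i : Fin n) (b c : Fin 2) :
    pullback (permute σ).real (tau i b c : Forms n) = tau (σ i) b c := by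
  simp only [coe_tau, coe_sitePair, map_add, map_mul, pullback_permute_dz]

lemma pullback_permute_vol {n : ℕ} (σ : Equiv.Perm (Fin n)) (i : Fin n) :
    pullback (permute σ).real (vol i : Forms n) = vol (σ i) := by
  simp only [coe_vol, coe_sitePair, map_mul, pullback_permute_dz]

/-- The sum of the volume forms of the sites. -/
def volSum (n : ℕ) : Z n := ∑ i, vol i

/-- A combination of site elements that is invariant is symmetric in the sites. -/
lemma eq_symmetrised {n : ℕ} (p : Fin 5 → MvPolynomial (Fin 3) ℂ)
    (h : ∑ k, ev (n + 1) (p k) * (siteElt n k : Forms (n + 1)) ∈ invariants (n + 1)) :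
    ((n : ℂ) + 1) • ∑ k, ev (n + 1) (p k) * (siteElt n k : Forms (n + 1)) =
      ((n : ℂ) + 1) • ev (n + 1) (p 0) + ev (n + 1) (p 1 * MvPolynomial.X 0 +
        p 2 * MvPolynomial.X 1 + p 3 * MvPolynomial.X 2) +
      ev (n + 1) (p 4) * volSum (n + 1) := by
  set ω := ∑ k, ev (n + 1) (p k) * (siteElt n k : Forms (n + 1)) with hω
  -- The transposition of `0` and `i` fixes `ω` and the generators and moves the site elements to
  -- site `i`; the claim is the sum of these identities over `i`.
  have key (i : Fin (n + 1)) : ω = ev (n + 1) (p 0) + (ev (n + 1) (p 1) * (tau i 0 0 : Z _) +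
      ev (n + 1) (p 2) * (tau i 0 1 : Z _) + ev (n + 1) (p 3) * (tau i 1 1 : Z _)) +
      ev (n + 1) (p 4) * (vol i : Z _) := by
    rw [← h (permute (Equiv.swap 0 i)), hω, Fin.sum_univ_five]
    change pullback _ (_ * Z.val _ 1 + _ * Z.val _ (tau 0 0 0) + _ * Z.val _ (tau 0 0 1) +
      _ * Z.val _ (tau 0 1 1) + _ * Z.val _ (vol 0)) = _
    simp only [map_add, map_mul, IsoEmb.pullback_ev, pullback_permute_tau, pullback_permute_vol,
      Equiv.swap_apply_left, map_one, mul_one]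
    abel
  have hsum : ((n : ℂ) + 1) • ω = ∑ _i : Fin (n + 1), ω := by
    rw [Finset.sum_const, Finset.card_univ, Fintype.card_fin, ← Nat.cast_smul_eq_nsmul ℂ]
    push_cast
    rfl
  rw [hsum, Finset.sum_congr rfl fun i _ => key i, Finset.sum_add_distrib, Finset.sum_add_distrib,
    Finset.sum_const, Finset.card_univ, Fintype.card_fin, ← Nat.cast_smul_eq_nsmul ℂ]
  simp only [Finset.sum_add_distrib, ← Finset.mul_sum, volSum, map_sum, map_add, map_mul, ev_X,
    gen, G, Matrix.cons_val]
  push_cast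
  rfl

lemma quatMatrix_add (p q : ℍ[ℝ]) (a b : Fin 2) :
    quatMatrix (p + q) a b = quatMatrix p a b + quatMatrix q a b :=
  map_add (coord (0 : Fin 1) a b) (fun _ => p) (fun _ => q)

lemma quatMatrix_sub (p q : ℍ[ℝ]) (a b : Fin 2) :
    quatMatrix (p - q) a b = quatMatrix p a b - quatMatrix q a b :=
  map_sub (coord (0 : Fin 1) a b) (fun _ => p) (fun _ => q)

lemma quatMatrix_smul (c : ℝ) (q : ℍ[ℝ]) (a b : Fin 2) :
    quatMatrix (c • q) a b = (c : ℂ) * quatMatrix q a b :=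
  map_smul (coord (0 : Fin 1) a b) c (fun _ => q)

lemma pullback_rotate_dz_left {n : ℕ} {i j : Fin n} (h : i ≠ j) (a b : Fin 2) :
    pullback (rotate i j h).real (dz i a b) =
      (((√2)⁻¹ : ℝ) : ℂ) • (dz i a b + dz j a b) := by
  rw [pullback_dz, dz, dz, ← map_add, ← map_smul]
  congr 1
  refine LinearMap.ext fun v => ?_
  have hv : (rotate i j h).real v i = (√2)⁻¹ • (v i + v j) := by simp [rotate, h]
  rw [LinearMap.comp_apply, coord_apply, hv, quatMatrix_smul, quatMatrix_add]
  rfl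

lemma pullback_rotate_dz_right {n : ℕ} {i j : Fin n} (h : i ≠ j) (a b : Fin 2) :
    pullback (rotate i j h).real (dz j a b) =
      (((√2)⁻¹ : ℝ) : ℂ) • (dz i a b - dz j a b) := by
  rw [pullback_dz, dz, dz, ← map_sub, ← map_smul]
  congr 1
  refine LinearMap.ext fun v => ?_
  have hv : (rotate i j h).real v j = (√2)⁻¹ • (v i - v j) := by simp [rotate]
  rw [LinearMap.comp_apply, coord_apply, hv, quatMatrix_smul, quatMatrix_sub]
  rfl

lemma pullback_rotate_dz_ne {n : ℕ} {i j k : Fin n} (h : i ≠ j) (hi : k ≠ i) (hj : k ≠ j)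
    (a b : Fin 2) : pullback (rotate i j h).real (dz k a b) = dz k a b := by
  rw [pullback_dz, dz]
  congr 1
  refine LinearMap.ext fun v => ?_
  simp [rotate, hi, hj, coord_apply]

/-- The mixed terms of the rotated volume forms of two sites. -/
def mixedVol {n : ℕ} (i j : Fin n) : Forms n :=
  sitePair i 0 0 * sitePair j 1 1 + sitePair i 1 1 * sitePair j 0 0 -
    dz i 0 0 * dz i 0 1 * (dz j 1 0 * dz j 1 1) - dz i 0 0 * dz i 1 1 * (dz j 0 1 * dz j 1 0) +
    dz i 1 0 * dz i 0 1 * (dz j 0 0 * dz j 1 1) - dz i 1 0 * dz i 1 1 * (dz j 0 0 * dz j 0 1)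

lemma dz_pair_commute {n : ℕ} (i j : Fin n) (a b c d : Fin 2) (ω : Forms n) :
    ω * (dz i a b * dz j c d) = dz i a b * dz j c d * ω :=
  Subalgebra.mem_center_iff.1 (ι_mul_ι_mem_center _ _) ω

lemma pullback_rotate_vol_add {n : ℕ} {i j : Fin n} (h : i ≠ j) :
    pullback (rotate i j h).real (vol i + vol j : Z n) =
      (1 / 2 : ℂ) • ((vol i + vol j : Z n) + mixedVol i j) := by
  have hs : ((((√2)⁻¹ : ℝ) : ℂ) * (((√2)⁻¹ : ℝ) : ℂ)) = 1 / 2 := by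
    rw [← Complex.ofReal_mul, ← mul_inv, Real.mul_self_sqrt zero_le_two]
    norm_num
  -- The terms with an odd number of factors from site `j` cancel and the even ones double. With the
  -- factor `1/2 * 1/2` from the four coordinates this gives the overall `1/2`.
  have hring (x x' y y' X X' Y Y' : Forms n) :
      (x + X) * (x' + X') * ((y + Y) * (y' + Y')) + (x - X) * (x' - X') * ((y - Y) * (y' - Y')) =
        (2 : ℂ) • (x * x' * (y * y') + X * X' * (Y * Y') + (x * x' * (Y * Y') +
          X * X' * (y * y') + x * (X' * y) * Y' + x * (X' * Y) * y' + X * (x' * y) * Y' +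
          X * (x' * Y) * y')) := by
    rw [two_smul]
    noncomm_ring
  have h1 : dz i 0 0 * (dz j 1 0 * dz i 0 1) * dz j 1 1 =
      -(dz i 0 0 * dz i 0 1 * (dz j 1 0 * dz j 1 1)) := by
    rw [dz_swap j i]; noncomm_ring
  have h2 : dz i 0 0 * (dz j 1 0 * dz j 0 1) * dz i 1 1 =
      -(dz i 0 0 * dz i 1 1 * (dz j 0 1 * dz j 1 0)) := by
    rw [dz_swap j j 1 0 0 1, mul_neg, neg_mul, mul_assoc,
      ← dz_pair_commute j j 0 1 1 0 (dz i 1 1), ← mul_assoc]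
  have h3 : dz j 0 0 * (dz i 1 0 * dz i 0 1) * dz j 1 1 =
      dz i 1 0 * dz i 0 1 * (dz j 0 0 * dz j 1 1) := by
    rw [dz_pair_commute i i 1 0 0 1, mul_assoc]
  have h4 : dz j 0 0 * (dz i 1 0 * dz j 0 1) * dz i 1 1 =
      -(dz i 1 0 * dz i 1 1 * (dz j 0 0 * dz j 0 1)) := by
    rw [dz_swap i j, dz_pair_commute j j 0 0 0 1]; noncomm_ring
  have h5 : dz j 0 0 * dz j 1 0 * (dz i 0 1 * dz i 1 1) =
      dz i 0 1 * dz i 1 1 * (dz j 0 0 * dz j 1 0) := dz_pair_commute _ _ _ _ _ _ _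
  simp only [map_add, coe_vol, coe_sitePair, map_mul, pullback_rotate_dz_left,
    pullback_rotate_dz_right, smul_mul_smul_comm, hs, ← smul_add, hring, h1, h2, h3, h4, h5,
    mixedVol, smul_smul]
  module

lemma pullback_rotate_volSum {n : ℕ} {i j : Fin n} (h : i ≠ j) :
    pullback (rotate i j h).real (volSum n : Forms n) =
      volSum n + (1 / 2 : ℂ) • (mixedVol i j - (vol i + vol j : Z n)) := by
  have hsplit : volSum n = (vol i + vol j) + ∑ k ∈ (Finset.univ.erase i).erase j, vol k := by
    rw [volSum, ← Finset.add_sum_erase _ _ (Finset.mem_univ i),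
      ← Finset.add_sum_erase _ _ (Finset.mem_erase.2 ⟨h.symm, Finset.mem_univ j⟩), add_assoc]
  have hrest : pullback (rotate i j h).real
      ((∑ k ∈ (Finset.univ.erase i).erase j, vol k : Z n) : Forms n) =
      (∑ k ∈ (Finset.univ.erase i).erase j, vol k : Z n) := by
    simp only [map_sum]
    refine Finset.sum_congr rfl fun k hk => ?_
    simp only [Finset.mem_erase] at hk
    simp only [coe_vol, coe_sitePair, map_mul, pullback_rotate_dz_ne h hk.2.1 hk.1]
  rw [hsplit, map_add (Z.val n), map_add, hrest, pullback_rotate_vol_add]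
  module

/-- Averaging at `j` kills the pairs of one-forms from the same row and symmetrises the others; what
survives is expressed by `tau` at both sites. -/
lemma siteAvg_mixedVol {n : ℕ} {i j : Fin n} (h : i ≠ j) :
    siteAvg j (mixedVol i j) = (1 / 2 : ℂ) •
      (((1 / 2 : ℂ) • (tau i 0 0 * tau j 1 1 + tau i 1 1 * tau j 0 0) -
        tau i 0 1 * tau j 0 1 : Z n) : Forms n) := by
  have hm (a b c d : Fin 2) (α : Forms n) : siteAvg j (dz i a b * dz i c d * α) =
      dz i a b * dz i c d * siteAvg j α := by
    refine mul_siteAvg j α ?_ ?_ <;> rw [map_mul] <;> congr 1 <;>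
      exact pullback_leftMulAt_dz_ne h _ _ _ _
  have h10 : dz i 1 0 * dz i 0 1 = -(sitePair i 1 0 : Forms n) := dz_swap _ _ _ _ _ _
  rw [mixedVol]
  simp only [map_add, map_sub, coe_sitePair, hm, siteAvg_dz_mul_dz]
  simp only [← coe_sitePair, siteAvg_sitePair, h10, map_smul, map_mul, map_add, coe_tau]
  simp only [mul_add, add_mul, mul_zero, sub_zero, mul_smul_comm, neg_mul]
  module

lemma siteAvg_vol_ne {n : ℕ} {i j : Fin n} (h : i ≠ j) :
    siteAvg j (vol i : Forms n) = vol i := by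
  rw [← mul_one (vol i : Forms n), mul_siteAvg, siteAvg_one]
  all_goals
    simp only [coe_vol, coe_sitePair, map_mul]
    congr 2 <;> exact pullback_leftMulAt_dz_ne h _ _ _ _

/-- `volSum` need not be invariant itself; the invariance of `p * volSum` is a constraint. Expanding
the discriminant-like form `G00 * G11 - G01 ^ 2` as a double sum of local terms `Y i j`, the
constraint evaluates every term multiplied by `p` through volume forms. -/
lemma ev_mul_volSum {n : ℕ} (p : MvPolynomial (Fin 3) ℂ)
    (h : ev n p * (volSum n : Forms n) ∈ invariants n) :
    (4 * n + 2 : ℂ) • (ev n p * (volSum n : Forms n)) =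
      ev n (p * (MvPolynomial.X 0 * MvPolynomial.X 2 - MvPolynomial.X 1 ^ 2)) := by
  let Y (i j : Fin n) : Z n := (1 / 2 : ℂ) • (tau i 0 0 * tau j 1 1 + tau i 1 1 * tau j 0 0) -
        tau i 0 1 * tau j 0 1
  -- Invariance under `rotate` gives `p * mixedVol i j = p * (vol i + vol j)`; averaging at site `j`
  -- then replaces `mixedVol i j` by `Y i j / 2`.
  have hne {i j : Fin n} (hij : i ≠ j) : evZ n p * Y i j = (2 : ℂ) • (evZ n p * (vol i + vol j)) := by
    have h1 := h (rotate i j hij)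
    rw [map_mul, IsoEmb.pullback_ev, pullback_rotate_volSum, mul_add, add_eq_left,
      mul_smul_comm, smul_eq_zero, or_iff_right (by norm_num), mul_sub, sub_eq_zero] at h1
    have h2 := congrArg (siteAvg j) h1
    rw [mul_siteAvg j _ (ev_mem_invariants n p _) (ev_mem_invariants n p _),
      mul_siteAvg j _ (ev_mem_invariants n p _) (ev_mem_invariants n p _), siteAvg_mixedVol hij,
      map_add, map_add, siteAvg_vol, siteAvg_vol_ne hij] at h2
    refine Z.val_injective n ?_
    rw [map_mul, map_smul, map_mul, map_add, ← ev_apply, ← h2, mul_smul_comm, smul_smul]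
    norm_num [Y]
  have hself (i : Fin n) : Y i i = (6 : ℂ) • vol i := by
    have h1 := sitePair_mul_right i 0 1 1
    have h2 := sitePair_mul_right i 1 0 0
    have h3 := sitePair_cross i
    simp only [Y, tau, vol] at *
    simp only [Algebra.smul_def]
    have e1 : algebraMap ℂ (Z n) (1 / 2) * 2 = 1 := by
      rw [← map_ofNat (algebraMap ℂ (Z n)) 2, ← map_mul]; norm_num
    have e2 : algebraMap ℂ (Z n) 6 = 6 := map_ofNat _ _
    rw [e2]
    linear_combination (4 * sitePair i 0 0 * sitePair i 1 1) * e1 - h1 - h2 - 2 * h3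
  -- The diagonal value 6 is 2 + 2 plus an excess of 2, so summing over `i` and `j` gives `2n + 2n +
  -- 2 = 4n + 2` times `p * volSum`.
  have hall (i j : Fin n) : evZ n p * Y i j = (2 : ℂ) • (evZ n p * vol i) +
      (2 : ℂ) • (evZ n p * vol j) + if i = j then (2 : ℂ) • (evZ n p * vol j) else 0 := by
    split_ifs with hij
    · subst hij
      rw [hself, mul_smul_comm]
      module
    · rw [hne hij, mul_add]
      module
  have hsum : ∑ i, ∑ j, Y i j = G n 0 0 * G n 1 1 - G n 0 1 ^ 2 := by
    have hG (b c b' c' : Fin 2) : G n b c * G n b' c' = ∑ i, ∑ j, tau i b c * tau j b' c' :=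
      Finset.sum_mul_sum _ _ _ _
    simp only [Y, Finset.sum_sub_distrib, ← Finset.smul_sum, Finset.sum_add_distrib, ← hG]
    rw [mul_comm (G n 1 1), sq, ← two_smul ℂ, smul_smul]
    norm_num
  have hgen : evZ n (p * (MvPolynomial.X 0 * MvPolynomial.X 2 - MvPolynomial.X 1 ^ 2)) =
      evZ n p * ∑ i, ∑ j, Y i j := by
    rw [hsum, map_mul, map_sub, map_mul, map_pow]
    simp only [evZ, MvPolynomial.aeval_X]
    rfl
  rw [ev_apply, ev_apply, hgen, ← map_mul, ← map_smul]
  refine congrArg (Z.val n) ?_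
  simp only [volSum, Finset.mul_sum, hall, Finset.sum_add_distrib, Finset.sum_ite_eq, Finset.mem_univ,
    if_true, Finset.sum_const, Finset.card_univ, Fintype.card_fin, ← Finset.smul_sum,
    ← Nat.cast_smul_eq_nsmul ℂ]
  module

/-- The first fundamental theorem: the invariant forms are generated by the three two-forms. -/
theorem exists_eq_ev_of_mem_invariants (n : ℕ) :
    ∀ ω ∈ invariants n, ∃ p, ω = ev n p := by
  induction n with
  | zero =>
    rintro ω -
    induction ω using ExteriorAlgebra.induction with
    | algebraMap r => exact ⟨algebraMap ℂ _ r, ((ev 0).commutes r).symm⟩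
    | ι x =>
      have : x = 0 := LinearMap.ext fun v => by rw [Subsingleton.elim v 0, map_zero, map_zero]
      exact ⟨0, by rw [this, map_zero, map_zero]⟩
    | mul a b ha hb =>
      obtain ⟨p, rfl⟩ := ha
      obtain ⟨q, rfl⟩ := hb
      exact ⟨p * q, (map_mul _ _ _).symm⟩
    | add a b ha hb =>
      obtain ⟨p, rfl⟩ := ha
      obtain ⟨q, rfl⟩ := hb
      exact ⟨p + q, (map_add _ _ _).symm⟩
  | succ n ih =>
    intro ω hω
    obtain ⟨p, rfl⟩ := invariants_le_siteSpan ih hω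
    have h1 := eq_symmetrised p hω
    -- In the symmetrised identity every other term is invariant, so this one is too.
    have hmem : ev (n + 1) (p 4) * (volSum (n + 1) : Forms (n + 1)) ∈ invariants (n + 1) := by
      rw [← sub_eq_iff_eq_add'] at h1
      rw [← h1]
      exact sub_mem (Subalgebra.smul_mem _ hω _) (add_mem
        (Subalgebra.smul_mem _ (ev_mem_invariants _ _) _) (ev_mem_invariants _ _))
    have h2 := ev_mul_volSum _ hmem
    have hn : (4 * (n + 1 : ℕ) + 2 : ℂ) ≠ 0 := by norm_cast
    have hn' : (n + 1 : ℂ) ≠ 0 := by norm_cast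
    rw [← eq_inv_smul_iff₀ hn] at h2
    rw [h2, ← eq_inv_smul_iff₀ hn'] at h1
    rw [h1]
    simp only [← map_smul, ← map_add]
    exact ⟨_, rfl⟩

/-! ### Independence of the generators in low degrees -/

lemma contract_dz_mul {n : ℕ} (d : Module.Dual ℂ (Hn n →ₗ[ℝ] ℂ)) (i : Fin n) (a b : Fin 2)
    (ω : Forms n) :
    contract d (dz i a b * ω) = d (coord i a b) • ω - dz i a b * contract d ω :=
  contract_ι_mul _ _ _

lemma contract_sitePair_mul {n : ℕ} (d : Module.Dual ℂ (Hn n →ₗ[ℝ] ℂ)) (i : Fin n)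
    (b c : Fin 2) (ω : Forms n) :
    contract d ((sitePair i b c : Forms n) * ω) = d (coord i 0 b) • (dz i 1 c * ω) -
      d (coord i 1 c) • (dz i 0 b * ω) + (sitePair i b c : Forms n) * contract d ω := by
  rw [coe_sitePair, mul_assoc, contract_dz_mul, contract_dz_mul, mul_sub, mul_smul_comm, mul_assoc]
  abel

/-- Contraction with two coordinates of the first site, followed by restriction to the last
coordinates. -/
def siteContract (n : ℕ) (b c : Fin 2) : Forms (n + 1) →ₗ[ℂ] Forms n :=
  (pullback (inclTail n).real).toLinearMap ∘ₗ contract (siteDual n 1 c) ∘ₗ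
    contract (siteDual n 0 b)

lemma siteContract_apply (n : ℕ) (b c : Fin 2) (ω : Forms (n + 1)) :
    siteContract n b c ω = pullback (inclTail n).real
      (contract (siteDual n 1 c) (contract (siteDual n 0 b) ω)) := rfl

lemma pullback_inclTail_dz_zero (n : ℕ) (a b : Fin 2) :
    pullback (inclTail n).real (dz 0 a b) = 0 := by
  have : coord 0 a b ∘ₗ (inclTail n).real = 0 := by
    refine LinearMap.ext fun v => ?_
    have h0 : (inclTail n).real v 0 = 0 := rfl
    rw [LinearMap.comp_apply, coord_apply, h0]
    fin_cases a <;> fin_cases b <;> simp [quatMatrix, Complex.ext_iff]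
  rw [pullback_dz, this, map_zero]

lemma pullback_inclTail_dz_succ {n : ℕ} (i : Fin n) (a b : Fin 2) :
    pullback (inclTail n).real (dz i.succ a b) = dz i a b := by
  rw [pullback_dz]; rfl

lemma siteContract_sitePair_zero_mul (n : ℕ) (b c b' c' : Fin 2) (ω : Forms (n + 1)) :
    siteContract n b c ((sitePair (0 : Fin (n + 1)) b' c' : Forms (n + 1)) * ω) =
      (if b = b' ∧ c = c' then (1 : ℂ) else 0) • pullback (inclTail n).real ω := by
  simp only [siteContract_apply, contract_sitePair_mul, map_sub, map_smul, contract_dz_mul,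
    siteDual_coord_zero, map_add, map_mul]
  simp only [coe_sitePair, map_mul, pullback_inclTail_dz_zero]
  by_cases hb : b = b' <;> by_cases hc : c = c' <;> simp [hb, hc]

lemma siteContract_sitePair_succ_mul {n : ℕ} (i : Fin n) (b c b' c' : Fin 2)
    (ω : Forms (n + 1)) :
    siteContract n b c ((sitePair i.succ b' c' : Forms (n + 1)) * ω) =
      (sitePair i b' c' : Forms n) * siteContract n b c ω := by
  simp only [siteContract_apply, contract_sitePair_mul, siteDual_coord_succ, zero_smul, sub_zero,
    zero_add, map_mul]
  simp only [coe_sitePair, map_mul, pullback_inclTail_dz_succ]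

/-- A Leibniz rule: terms that keep a one-form of the first site die on restriction. The constants
2, 1, 2 occur because `tau 0 b b` is twice a `sitePair`, while `tau 0 0 1` contains `sitePair 0 0 1`
once. -/
lemma siteContract_gen_mul (n : ℕ) (k l : Fin 3) (ω : Forms (n + 1)) :
    siteContract n (![0, 0, 1] l) (![0, 1, 1] l) ((gen (n + 1) k : Forms (n + 1)) * ω) =
      (if k = l then (![2, 1, 2] l : ℂ) else 0) • pullback (inclTail n).real ω +
        (gen n k : Forms n) * siteContract n (![0, 0, 1] l) (![0, 1, 1] l) ω := by
  rw [gen_eq_G, gen_eq_G, G, G, Fin.sum_univ_succ]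
  simp only [map_add, map_sum, tau, add_mul, Finset.sum_mul, siteContract_sitePair_zero_mul,
    siteContract_sitePair_succ_mul]
  congr 1
  rw [← add_smul]
  congr 1
  fin_cases k <;> fin_cases l <;> simp <;> norm_num

lemma siteContract_ev (n : ℕ) (l : Fin 3) (p : MvPolynomial (Fin 3) ℂ) :
    siteContract n (![0, 0, 1] l) (![0, 1, 1] l) (ev (n + 1) p) =
      (![2, 1, 2] l : ℂ) • ev n (MvPolynomial.pderiv l p) := by
  induction p using MvPolynomial.induction_on with
  | C a =>
    rw [MvPolynomial.pderiv_C, ← MvPolynomial.algebraMap_eq, AlgHom.commutes,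
      siteContract_apply, contract_algebraMap]
    simp
  | add p q hp hq => simp only [map_add, hp, hq, smul_add]
  | mul_X p k hp =>
    rw [mul_comm, map_mul, ev_X, siteContract_gen_mul, hp, IsoEmb.pullback_ev, Derivation.leibniz,
      MvPolynomial.pderiv_X, map_add, smul_eq_mul, smul_eq_mul, map_mul, map_mul, ev_X,
      mul_smul_comm, smul_add, add_comm]
    congr 1
    by_cases h : k = l
    · subst h; simp
    · simp [h]

/-- Each step lowers both the dimension and the degree bound by one: by `siteContract_ev` and
induction all partial derivatives of `p` vanish, so `p` is constant in characteristic zero, and `ev`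
is injective on constants. -/
theorem eq_zero_of_ev_eq_zero (n : ℕ) (p : MvPolynomial (Fin 3) ℂ) (hp : p.totalDegree ≤ n)
    (h : ev n p = 0) : p = 0 := by
  have hC (n : ℕ) (p : MvPolynomial (Fin 3) ℂ) (hp : p = MvPolynomial.C (p.coeff 0))
      (h : ev n p = 0) : p = 0 := by
    rw [hp, ← MvPolynomial.algebraMap_eq, AlgHom.commutes,
      ExteriorAlgebra.algebraMap_eq_zero_iff] at h
    rw [hp, h, map_zero]
  induction n generalizing p with
  | zero => exact hC 0 p (MvPolynomial.totalDegree_eq_zero_iff_eq_C.1 (Nat.le_zero.1 hp)) h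
  | succ n ih =>
    have hd (l : Fin 3) : MvPolynomial.pderiv l p = 0 := by
      refine ih _ (Finset.sup_le fun m hm => ?_) ?_
      · rw [MvPolynomial.mem_support_iff, MvPolynomial.coeff_pderiv] at hm
        have h1 := MvPolynomial.le_totalDegree (MvPolynomial.mem_support_iff.2 (left_ne_zero_of_mul hm))
        rw [Finsupp.sum_add_index' (fun _ => rfl) (fun _ _ _ => rfl),
          Finsupp.sum_single_index rfl] at h1
        lia
      · have h1 := siteContract_ev n l p
        rw [h, map_zero, eq_comm, smul_eq_zero] at h1
        refine h1.resolve_left ?_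
        fin_cases l <;> simp
    refine hC (n + 1) p (MvPolynomial.ext _ _ fun m => ?_) h
    rcases eq_or_ne m 0 with rfl | hm
    · simp
    · obtain ⟨l, hl⟩ := Finsupp.ne_iff.1 hm
      have h1 := congrArg (MvPolynomial.coeff (m - Finsupp.single l 1)) (hd l)
      have h2 : m - Finsupp.single l 1 + Finsupp.single l 1 = m :=
        tsub_add_cancel_of_le (Finsupp.single_le_iff.2 (Nat.one_le_iff_ne_zero.2 hl))
      rw [MvPolynomial.coeff_pderiv, h2, MvPolynomial.coeff_zero, mul_eq_zero] at h1
      rw [MvPolynomial.coeff_C, if_neg hm.symm]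
      exact h1.resolve_right (by norm_cast)

/-! ### Degrees -/

lemma sitePair_mem {n : ℕ} (i : Fin n) (b c : Fin 2) :
    (sitePair i b c : Forms n) ∈ FormsDeg n 2 := by
  change _ ∈ _ ^ 2
  rw [pow_two]
  exact Submodule.mul_mem_mul ⟨_, rfl⟩ ⟨_, rfl⟩

lemma gen_mem (n : ℕ) (k : Fin 3) : (gen n k : Forms n) ∈ FormsDeg n 2 := by
  rw [gen_eq_G, G, map_sum]
  refine sum_mem fun i _ => ?_
  rw [tau, map_add]
  exact add_mem (sitePair_mem _ _ _) (sitePair_mem _ _ _)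

lemma ev_monomial_mem (n : ℕ) (m : Fin 3 →₀ ℕ) (a : ℂ) :
    ev n (MvPolynomial.monomial m a) ∈ FormsDeg n (2 * m.degree) := by
  induction m using Finsupp.induction_linear generalizing a with
  | zero =>
    rw [map_zero, mul_zero, ← MvPolynomial.C_apply, ← MvPolynomial.algebraMap_eq,
      AlgHom.commutes]
    exact SetLike.algebraMap_mem_graded (fun i : ℕ => FormsDeg n i) a
  | add f g hf hg =>
    rw [← mul_one a, ← MvPolynomial.monomial_mul, map_mul, map_add, mul_add]
    exact SetLike.GradedMul.mul_mem (A := fun i : ℕ => FormsDeg n i) (hf a) (hg 1)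
  | single k e =>
    rw [← MvPolynomial.C_mul_X_pow_eq_monomial, map_mul, ← MvPolynomial.algebraMap_eq,
      AlgHom.commutes, ← Algebra.smul_def, map_pow, ev_X, Finsupp.degree_single, mul_comm]
    exact Submodule.smul_mem _ _
      (SetLike.pow_mem_graded (A := fun i : ℕ => FormsDeg n i) e (gen_mem n k))

lemma ev_mem_of_isHomogeneous (n : ℕ) {d : ℕ} {p : MvPolynomial (Fin 3) ℂ}
    (hp : p.IsHomogeneous d) : ev n p ∈ FormsDeg n (2 * d) := by
  rw [p.as_sum, map_sum]
  refine sum_mem fun m hm => ?_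
  have h := ev_monomial_mem n m (p.coeff m)
  have hd : m.degree = d := by
    rw [Finsupp.degree_eq_weight_one]
    exact hp (MvPolynomial.mem_support_iff.1 hm)
  rwa [hd] at h

/-- An invariant form of degree `k` is the value of a polynomial of degree `k / 2`. -/
lemma exists_eq_ev_of_mem_invForms {n k : ℕ} {ω : Forms n}
    (h : ω ∈ (invForms n k).toSubmodule) :
    ∃ p : MvPolynomial (Fin 3) ℂ, ω = ev n p ∧ p.totalDegree ≤ k ∧
      ∀ m, ev m p ∈ FormsDeg m k := by
  obtain ⟨hk, hinv⟩ := mem_invForms_iff.1 h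
  obtain ⟨p, rfl⟩ := exists_eq_ev_of_mem_invariants n ω hinv
  -- Keeps only the component of degree `k / 2`; the sum is empty for odd `k`, or if `p` has no
  -- component that high. Since `ev` doubles degrees, the discarded components do not contribute to
  -- the degree `k` form.
  refine ⟨∑ d ∈ (Finset.range (p.totalDegree + 1)).filter (fun d => 2 * d = k),
    MvPolynomial.homogeneousComponent d p, ?_, ?_, fun m => ?_⟩
  · have h1 : GradedRing.proj (fun i : ℕ => FormsDeg n i) k (ev n p) = ev n p := by
      rw [GradedRing.proj_apply, DirectSum.decompose_of_mem_same _ hk]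
    rw [← h1]
    conv_lhs => rw [← MvPolynomial.sum_homogeneousComponent p]
    rw [map_sum, map_sum, map_sum, Finset.sum_filter]
    refine Finset.sum_congr rfl fun d _ => ?_
    have h2 := ev_mem_of_isHomogeneous n (MvPolynomial.homogeneousComponent_isHomogeneous d p)
    rw [GradedRing.proj_apply]
    split_ifs with hd
    · rw [← hd, DirectSum.decompose_of_mem_same _ h2]
    · rw [DirectSum.decompose_of_mem_ne _ h2 hd]
  · refine MvPolynomial.totalDegree_finsetSum_le fun d hd => ?_
    have := (MvPolynomial.homogeneousComponent_isHomogeneous d p).totalDegree_le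
    rw [Finset.mem_filter] at hd
    lia
  · rw [map_sum]
    refine sum_mem fun d hd => ?_
    rw [← (Finset.mem_filter.1 hd).2]
    exact ev_mem_of_isHomogeneous m (MvPolynomial.homogeneousComponent_isHomogeneous d p)

/-! ### The inverse limit -/

/-- Evaluation of polynomials at the sequences of generators. -/
def evSeq : MvPolynomial (Fin 3) ℂ →ₐ[ℂ] ∀ n, Forms n := AlgHom.pi ev

lemma evSeq_apply (p : MvPolynomial (Fin 3) ℂ) (n : ℕ) : evSeq p n = ev n p := rfl

lemma evSeq_injective : Function.Injective evSeq := by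
  refine (injective_iff_map_eq_zero _).2 fun p hp => ?_
  exact eq_zero_of_ev_eq_zero p.totalDegree p le_rfl (congrFun hp _)

variable (ι : ∀ n, IsoEmb n (n + 1))

lemma evSeq_mem_limDeg {k : ℕ} {p : MvPolynomial (Fin 3) ℂ} (hp : ∀ m, ev m p ∈ FormsDeg m k) :
    evSeq p ∈ LimDeg ι k :=
  ⟨fun n => mem_invForms_iff.2 ⟨hp n, ev_mem_invariants n p⟩, fun n => (ι n).pullback_ev p⟩

variable {ι}

lemma eq_ev_of_le {k m n : ℕ} (hmn : m ≤ n) {ω : ∀ n, Forms n} (hω : ω ∈ LimDeg ι k)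
    {p : MvPolynomial (Fin 3) ℂ} (h : ω n = ev n p) : ω m = ev m p := by
  induction n, hmn using Nat.le_induction with
  | base => exact h
  | succ n _ ih =>
    refine ih ?_
    rw [← hω.2 n, h, (ι n).pullback_ev]

/-- Below `n` the form is found by restriction. Above `n` it comes from some polynomial `q` of
degree at most `k`; restricting to `ℍ^n` gives `ev n (q - p) = 0`, and independence forces `q = p`.
-/
lemma eq_evSeq {k n : ℕ} (hkn : k ≤ n) {ω : ∀ n, Forms n} (hω : ω ∈ LimDeg ι k)
    {p : MvPolynomial (Fin 3) ℂ} (hp : p.totalDegree ≤ k) (h : ω n = ev n p) : ω = evSeq p := by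
  funext m
  rcases le_total m n with hm | hm
  · exact eq_ev_of_le hm hω h
  · obtain ⟨q, hq, hqd, -⟩ := exists_eq_ev_of_mem_invForms (hω.1 m)
    have h1 : ev n (q - p) = 0 := by
      rw [map_sub, sub_eq_zero, ← h, eq_ev_of_le hm hω hq]
    have h2 := eq_zero_of_ev_eq_zero n (q - p)
      (((MvPolynomial.totalDegree_sub _ _).trans (max_le hqd hp)).trans hkn) h1
    rw [hq, sub_eq_zero.1 h2, evSeq_apply]

lemma exists_eq_evSeq {k : ℕ} {ω : ∀ n, Forms n} (hω : ω ∈ LimDeg ι k) : ∃ p, ω = evSeq p := by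
  obtain ⟨p, hp, hpd, -⟩ := exists_eq_ev_of_mem_invForms (hω.1 k)
  exact ⟨p, eq_evSeq le_rfl hω hpd hp⟩

lemma restr_injective {k n : ℕ} (hkn : k ≤ n) : Function.Injective (restr ι k n) := by
  refine (injective_iff_map_eq_zero _).2 fun ω hω => Subtype.ext ?_
  have h : ω.1 n = ev n 0 := by
    rw [map_zero]
    exact congrArg Subtype.val hω
  rw [eq_evSeq hkn ω.2 (by simp) h, map_zero]
  rfl

/-- The polynomial representing a form on `ℍ^n` can be evaluated in every dimension, and this gives
a compatible sequence. -/
lemma restr_surjective (k n : ℕ) : Function.Surjective (restr ι k n) := by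
  rintro ⟨ω, hω⟩
  obtain ⟨p, rfl, -, hp⟩ := exists_eq_ev_of_mem_invForms hω
  exact ⟨⟨evSeq p, evSeq_mem_limDeg ι hp⟩, rfl⟩

lemma proj_coeAlgHom (x : LimAlg ι) (n k : ℕ) :
    GradedRing.proj (fun i : ℕ => FormsDeg n i) k (DirectSum.coeAlgHom (LimDeg ι) x n) =
      (x k).1 n := by
  induction x using DirectSum.induction_on with
  | zero => simp
  | of i ω =>
    rw [DirectSum.coeAlgHom_of, GradedRing.proj_apply]
    rcases eq_or_ne i k with rfl | h
    · rw [DirectSum.decompose_of_mem_same _ (ω.2.1 n).1, DirectSum.of_eq_same]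
    · rw [DirectSum.decompose_of_mem_ne _ (ω.2.1 n).1 h, DirectSum.of_eq_of_ne _ _ _ h.symm]
      rfl
  | add x y hx hy =>
    rw [map_add, Pi.add_apply, map_add, hx, hy]
    rfl

/-- The grading of each `Forms n` recovers the components, so the limit algebra embeds in the
algebra of sequences and can be compared there with the range of `evSeq`. -/
lemma coeAlgHom_injective : Function.Injective (DirectSum.coeAlgHom (LimDeg ι)) := by
  refine (injective_iff_map_eq_zero _).2 fun x hx => ?_
  refine DFinsupp.ext fun k => Subtype.ext (funext fun n => ?_)
  rw [← proj_coeAlgHom, hx, Pi.zero_apply, map_zero]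
  rfl

variable (ι)

/-- The generators of the limit algebra. -/
def limGen (k : Fin 3) : LimDeg ι 2 :=
  ⟨evSeq (MvPolynomial.X k), evSeq_mem_limDeg ι fun m => by rw [ev_X]; exact gen_mem m k⟩

lemma range_evSeq : evSeq.range = (DirectSum.coeAlgHom (LimDeg ι)).range := by
  refine le_antisymm ?_ ?_
  · rintro _ ⟨p, rfl⟩
    change evSeq p ∈ _
    induction p using MvPolynomial.induction_on with
    | C a =>
      rw [← MvPolynomial.algebraMap_eq, AlgHom.commutes]
      exact Subalgebra.algebraMap_mem _ _
    | add p q hp hq => rw [map_add]; exact add_mem hp hq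
    | mul_X p k hp =>
      rw [map_mul]
      exact mul_mem hp ⟨DirectSum.of (fun k => LimDeg ι k) 2 (limGen ι k),
        DirectSum.coeAlgHom_of _ _ _⟩
  · rintro _ ⟨x, rfl⟩
    change DirectSum.coeAlgHom (LimDeg ι) x ∈ _
    induction x using DirectSum.induction_on with
    | zero => rw [map_zero]; exact zero_mem _
    | of i ω =>
      obtain ⟨p, hp⟩ := exists_eq_evSeq ω.2
      rw [DirectSum.coeAlgHom_of, hp]
      exact ⟨p, rfl⟩
    | add x y hx hy => rw [map_add]; exact add_mem hx hy

/-- The limit algebra is a polynomial algebra in three variables. -/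
def limEquiv : MvPolynomial (Fin 3) ℂ ≃ₐ[ℂ] LimAlg ι :=
  (AlgEquiv.ofInjective evSeq evSeq_injective).trans
    ((Subalgebra.equivOfEq _ _ (range_evSeq ι)).trans
      (AlgEquiv.ofInjective _ (coeAlgHom_injective (ι := ι))).symm)

lemma coeAlgHom_limEquiv (p : MvPolynomial (Fin 3) ℂ) :
    DirectSum.coeAlgHom (LimDeg ι) (limEquiv ι p) = evSeq p :=
  congrArg Subtype.val ((AlgEquiv.ofInjective _ (coeAlgHom_injective (ι := ι))).apply_symm_apply
    (Subalgebra.equivOfEq _ _ (range_evSeq ι) (AlgEquiv.ofInjective evSeq evSeq_injective p)))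

lemma limEquiv_X (k : Fin 3) :
    limEquiv ι (MvPolynomial.X k) = DirectSum.lof ℂ ℕ (fun k => LimDeg ι k) 2 (limGen ι k) := by
  refine coeAlgHom_injective ?_
  rw [coeAlgHom_limEquiv]
  exact (DirectSum.coeAlgHom_of (LimDeg ι) 2 (limGen ι k)).symm

/-! ### The representation `V_2` and equivariance -/

/-- The product of two standard basis vectors, in `V_2`. -/
def symProd (b c : Fin 2) : V 2 :=
  ⟨SymmetricAlgebra.ι ℂ (Fin 2 → ℂ) (Pi.single b 1) *
    SymmetricAlgebra.ι ℂ (Fin 2 → ℂ) (Pi.single c 1), by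
    change _ ∈ _ ^ 2
    rw [pow_two]
    exact Submodule.mul_mem_mul ⟨_, rfl⟩ ⟨_, rfl⟩⟩

lemma symProd_symm (b c : Fin 2) : symProd b c = symProd c b := Subtype.ext (mul_comm _ _)

lemma coe_symProd (b c : Fin 2) :
    (symProd b c : SymmetricAlgebra ℂ (Fin 2 → ℂ)) =
      SymmetricAlgebra.ι ℂ (Fin 2 → ℂ) (Pi.single b 1) *
        SymmetricAlgebra.ι ℂ (Fin 2 → ℂ) (Pi.single c 1) := rfl

lemma ι_eq_sum_single (u : Fin 2 → ℂ) : SymmetricAlgebra.ι ℂ (Fin 2 → ℂ) u =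
    ∑ b, u b • SymmetricAlgebra.ι ℂ (Fin 2 → ℂ) (Pi.single b 1) := by
  simp only [← map_smul, ← map_sum]
  congr 1
  exact pi_eq_sum_univ' u

lemma ι_mul_ι_eq_sum_symProd (u w : Fin 2 → ℂ) :
    SymmetricAlgebra.ι ℂ (Fin 2 → ℂ) u * SymmetricAlgebra.ι ℂ (Fin 2 → ℂ) w =
      ∑ b, ∑ c, (u b * w c) • (symProd b c : SymmetricAlgebra ℂ (Fin 2 → ℂ)) := by
  rw [ι_eq_sum_single u, ι_eq_sum_single w, Finset.sum_mul_sum]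
  simp only [smul_mul_smul_comm, coe_symProd]

/-- The products of basis vectors indexed like the generators. -/
def symGen (k : Fin 3) : V 2 := symProd (![0, 0, 1] k) (![0, 1, 1] k)

lemma linearIndependent_symGen :
    LinearIndependent ℂ (fun k => (symGen k : SymmetricAlgebra ℂ (Fin 2 → ℂ))) := by
  let e := SymmetricAlgebra.equivMvPolynomial (Pi.basisFun ℂ (Fin 2))
  refine LinearIndependent.of_comp e.toLinearMap ?_
  have he (b : Fin 2) : e (SymmetricAlgebra.ι ℂ (Fin 2 → ℂ) (Pi.single b 1)) =
      MvPolynomial.X b := by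
    rw [← Pi.basisFun_apply]
    exact SymmetricAlgebra.equivMvPolynomial_ι_apply _ _
  let f : Fin 3 → Fin 2 →₀ ℕ := fun k =>
    Finsupp.single (![0, 0, 1] k) 1 + Finsupp.single (![0, 1, 1] k) 1
  have hf : Function.Injective f := by
    -- The exponents of the first variable are 2, 1, 0, which already separates the three monomials.
    intro k l h
    have h0 := DFunLike.congr_fun h 0
    fin_cases k <;> fin_cases l <;> simp [f] at h0 ⊢
  have hef : (e.toLinearMap ∘ fun k => (symGen k : SymmetricAlgebra ℂ (Fin 2 → ℂ))) =
      MvPolynomial.basisMonomials (Fin 2) ℂ ∘ f := by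
    funext k
    change e (symProd (![0, 0, 1] k) (![0, 1, 1] k) : SymmetricAlgebra ℂ (Fin 2 → ℂ)) = _
    rw [coe_symProd, map_mul, he, he]
    simp [f, MvPolynomial.X, MvPolynomial.monomial_mul]
  rw [hef]
  exact (MvPolynomial.basisMonomials (Fin 2) ℂ).linearIndependent.comp f hf

lemma span_symGen : Submodule.span ℂ (Set.range
    (fun k => (symGen k : SymmetricAlgebra ℂ (Fin 2 → ℂ)))) = (symPower 2).toSubmodule := by
  refine le_antisymm (Submodule.span_le.2 ?_) ?_
  · rintro _ ⟨k, rfl⟩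
    exact (symGen k).2
  · change LinearMap.range (SymmetricAlgebra.ι ℂ (Fin 2 → ℂ)) ^ 2 ≤ _
    rw [pow_two, Submodule.mul_le]
    rintro _ ⟨u, rfl⟩ _ ⟨w, rfl⟩
    rw [ι_mul_ι_eq_sum_symProd]
    refine sum_mem fun b _ => sum_mem fun c _ => Submodule.smul_mem _ _ (Submodule.subset_span ?_)
    fin_cases b <;> fin_cases c
    · exact ⟨0, rfl⟩
    · exact ⟨1, rfl⟩
    · exact ⟨1, congrArg Subtype.val (symProd_symm 0 1)⟩
    · exact ⟨2, rfl⟩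

/-- The basis of `V_2` corresponding to the generators. -/
def symBasis : Module.Basis (Fin 3) ℂ (V 2) :=
  (Module.Basis.span linearIndependent_symGen).map (LinearEquiv.ofEq _ _ span_symGen)

lemma symBasis_apply (k : Fin 3) : symBasis k = symGen k := by
  have h := congrArg Subtype.val (Module.Basis.span_apply linearIndependent_symGen k)
  exact Subtype.ext h

lemma repV_symProd (A : SU2) (b c : Fin 2) :
    repV 2 A (symProd b c) = ∑ b', ∑ c', (A.1 b' b * A.1 c' c) • symProd b' c' := by
  refine Subtype.ext ?_
  have hι (b : Fin 2) : SymmetricAlgebra.lift (SymmetricAlgebra.ι ℂ (Fin 2 → ℂ) ∘ₗ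
      A.1.mulVecLin) (SymmetricAlgebra.ι ℂ (Fin 2 → ℂ) (Pi.single b 1)) =
      SymmetricAlgebra.ι ℂ (Fin 2 → ℂ) (fun b' => A.1 b' b) := by
    rw [SymmetricAlgebra.lift_ι_apply, LinearMap.comp_apply, Matrix.mulVecLin_apply,
      Matrix.mulVec_single_one]
    rfl
  have h : (repV 2 A (symProd b c) : SymmetricAlgebra ℂ (Fin 2 → ℂ)) =
      SymmetricAlgebra.lift (SymmetricAlgebra.ι ℂ (Fin 2 → ℂ) ∘ₗ A.1.mulVecLin)
        (symProd b c) := rfl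
  rw [h, coe_symProd, map_mul, hι, hι, ι_mul_ι_eq_sum_symProd]
  simp only [Submodule.coe_sum, Submodule.coe_smul]

/-- Right multiplication multiplies the coordinate matrix by `A` on the right, so only the column
index is affected, and it transforms like a basis vector of `ℂ²`. -/
lemma formsRep_dz {n : ℕ} (A : SU2) (i : Fin n) (a b : Fin 2) :
    formsRep n A (dz i a b) = ∑ b', A.1 b' b • dz i a b' := by
  change pullback (rightMul n (su2ToQuat A)) (dz i a b) = _
  rw [pullback_dz]
  simp only [dz, ← map_smul, ← map_sum]
  congr 1
  refine LinearMap.ext fun v => ?_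
  have h : quatMatrix (v i * su2ToQuat A) = quatMatrix (v i) * A.1 := by
    rw [quatMatrix_mul]
    exact congrArg _ (quatMatrix_quatOfMatrix A)
  change quatMatrix (v i * su2ToQuat A) a b = _
  rw [h, Matrix.mul_apply, LinearMap.sum_apply]
  exact Finset.sum_congr rfl fun c _ => mul_comm _ _

lemma formsRep_mul {n : ℕ} (A : SU2) (α β : Forms n) :
    formsRep n A (α * β) = formsRep n A α * formsRep n A β := map_mul (pullback _) α β

lemma formsRep_G {n : ℕ} (A : SU2) (b c : Fin 2) :
    formsRep n A (G n b c : Forms n) =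
      ∑ b', ∑ c', (A.1 b' b * A.1 c' c) • (G n b' c' : Forms n) := by
  have hs (i : Fin n) (b c : Fin 2) : formsRep n A (sitePair i b c : Forms n) =
      ∑ b', ∑ c', (A.1 b' b * A.1 c' c) • (sitePair i b' c' : Forms n) := by
    simp only [coe_sitePair, formsRep_mul, formsRep_dz, Finset.sum_mul_sum, smul_mul_smul_comm]
  have ht (i : Fin n) : formsRep n A (tau i b c : Forms n) =
      ∑ b', ∑ c', (A.1 b' b * A.1 c' c) • (tau i b' c' : Forms n) := by
    simp only [coe_tau, map_add, hs, smul_add, Finset.sum_add_distrib]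
    congr 1
    rw [Finset.sum_comm]
    simp only [mul_comm]
  simp only [G, map_sum, ht, Finset.smul_sum]
  rw [Finset.sum_comm]
  exact Finset.sum_congr rfl fun _ _ => Finset.sum_comm

/-- The linear map from `V_2` to the limit matching the bases. -/
def limMap : V 2 →ₗ[ℂ] LimDeg ι 2 := symBasis.constr ℂ (limGen ι)

lemma limMap_symGen (k : Fin 3) : limMap ι (symGen k) = limGen ι k := by
  rw [← symBasis_apply, limMap, Module.Basis.constr_basis]

lemma limMap_symProd (b c : Fin 2) (n : ℕ) :
    (limMap ι (symProd b c)).1 n = (G n b c : Forms n) := by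
  have h (k : Fin 3) : (limMap ι (symGen k)).1 n = (gen n k : Forms n) := by
    rw [limMap_symGen]
    exact ev_X n k
  have hG : G n 1 0 = G n 0 1 := Finset.sum_congr rfl fun i _ => tau_symm i 1 0
  fin_cases b <;> fin_cases c
  · exact h 0
  · exact h 1
  · change (limMap ι (symProd 1 0)).1 n = (G n 1 0 : Forms n)
    rw [symProd_symm, hG]
    exact h 1
  · exact h 2

/-- The coefficients in `repV_symProd` and `formsRep_G` coincide, so equivariance can be read off at
each `n`. -/
lemma limMap_equivariant (A : SU2) : limMap ι ∘ₗ repV 2 A = limRep ι 2 A ∘ₗ limMap ι := by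
  refine symBasis.ext fun k => Subtype.ext (funext fun n => ?_)
  rw [LinearMap.comp_apply, LinearMap.comp_apply, symBasis_apply, symGen, repV_symProd]
  have h : (limRep ι 2 A (limMap ι (symProd (![0, 0, 1] k) (![0, 1, 1] k)))).1 n =
      formsRep n A ((limMap ι (symProd (![0, 0, 1] k) (![0, 1, 1] k))).1 n) := rfl
  rw [h, limMap_symProd, formsRep_G]
  simp only [map_sum, map_smul, Submodule.coe_sum, Submodule.coe_smul, Finset.sum_apply,
    Pi.smul_apply, limMap_symProd]

end

end QuatForms

theorem mainTheorem7 (ι : ∀ n : ℕ, QuatForms.IsoEmb n (n + 1)) :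
    (∃ φ : Representation.IntertwiningMap (QuatForms.repV 2) (QuatForms.limRep ι 2),
      ∃ Φ : SymmetricAlgebra ℂ (QuatForms.V 2) ≃ₐ[ℂ] QuatForms.LimAlg ι,
        ∀ x : QuatForms.V 2, Φ (SymmetricAlgebra.ι ℂ (QuatForms.V 2) x) =
          DirectSum.lof ℂ ℕ (fun k => QuatForms.LimDeg ι k) 2 (φ x)) ∧
    (∀ k n : ℕ,
      Representation.IsIntertwiningMap (QuatForms.limRep ι k) (QuatForms.invRep n k)
        (QuatForms.restr ι k n) ∧
      Function.Surjective (QuatForms.restr ι k n) ∧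
      (k ≤ n → Function.Injective (QuatForms.restr ι k n))) := by
  refine ⟨⟨⟨QuatForms.limMap ι, QuatForms.limMap_equivariant ι⟩,
    (SymmetricAlgebra.equivMvPolynomial QuatForms.symBasis).trans (QuatForms.limEquiv ι),
    fun x => ?_⟩, fun k n => ⟨⟨fun _ _ => rfl⟩, QuatForms.restr_surjective k n,
      QuatForms.restr_injective⟩⟩
  have h : ((SymmetricAlgebra.equivMvPolynomial QuatForms.symBasis).trans
      (QuatForms.limEquiv ι)).toLinearMap ∘ₗ SymmetricAlgebra.ι ℂ (QuatForms.V 2) =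
      DirectSum.lof ℂ ℕ (fun k => QuatForms.LimDeg ι k) 2 ∘ₗ QuatForms.limMap ι := by
    refine QuatForms.symBasis.ext fun k => ?_
    rw [LinearMap.comp_apply, LinearMap.comp_apply, AlgEquiv.toLinearMap_apply,
      AlgEquiv.trans_apply, SymmetricAlgebra.equivMvPolynomial_ι_apply, QuatForms.limEquiv_X,
      QuatForms.symBasis_apply, QuatForms.limMap_symGen]
  exact LinearMap.congr_fun h x
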